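/- \textbf{Definitions.} An instance of \textsc{IR-Topological Distance Game} (IR-TDG) consists of a finite simple undirected graph $G=(V,E)$, a finite set $N$ of agents with $|N|\le |V|$, utilities $u_i\colon N\to\mathbb{R}$ with $u_i(i)=0$ for every agent $i\in N$, and a distance factor function, that is, a strictly decreasing function $f\colon\mathbb{N}\to\mathbb{R}_{>0}$, extended by $f(\infty)=0$. An assignment is an injective map $\alpha\colon N\to V$, and the utility of agent $i$ in $\alpha$ is \[ u_i(\alpha)=\sum_{j\in N\setminus\{i\}} u_i(j)\cdot f\bigl(\mathrm{dist}_G(\alpha(i),\alpha(j))\bigr), \] where $\mathrm{dist}_G(v,w)=\infty$ if $v$ and $w$ lie in different components of $G$. The assignment is individually rational if $u_i(\alpha)\ge 0$ for every $i\in N$. The question is whether there is an individually rational assignment. The input consists of $|N|$, $|V|$, the adjacency matrix of $G$, the numbers $u_i(j)$ for $i,j\in N$, and the numbers $f(d)$ for $1\le d<|V|$. \textbf{Theorem.} Restricted to instances in which at most one agent $p$ assigns negative utility to other agents (that is, $u_i(j)<0$ for some $j$ holds for at most one agent $i$), IR-TDG can be solved in polynomial time for any distance factor function. More precisely, there is a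 single random access machine program, independent of the instance, which decides IR-TDG on all such instances \begin{itemize} \item with real utilities and factors, in time polynomial in the size of the input, when real numbers have size $1$ and additions, subtractions, multiplications and comparisons of real numbers have unit cost (real RAM), and \item with rational utilities and factors, in time polynomial in the bit length of the input, when every operation is charged the bit lengths of the numbers involved (logarithmic cost). \end{itemize} -/

import Mathlib

/-! ## Topological distance games -/

/-- An instance of the topological distance game problem with numbers in the ordered field `K`.
The agents are `Fin n`, the vertices of the topology are `Fin m`.  The distance factor function
is extended to the distance `∞` by the value `0` in `TDG.factor`. -/
structure TDG (K : Type) [Field K] [LinearOrder K] where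
  /-- number of agents -/
  n : ℕ
  /-- number of vertices of the topology -/
  m : ℕ
  agents_le : n ≤ m
  /-- the topology -/
  G : SimpleGraph (Fin m)
  /-- `u i j` is the utility that agent `i` assigns to agent `j` -/
  u : Fin n → Fin n → K
  u_self : ∀ i, u i i = 0
  /-- the distance factor function -/
  f : ℕ → K
  f_pos : ∀ d, 0 < f d
  f_anti : StrictAnti f

namespace TDG

variable {K : Type} [Field K] [LinearOrder K]

open Classical in
/-- The distance factor function on extended distances, with value `0` at `∞`. -/
noncomputable def factor (I : TDG K) (d : ℕ∞) : K :=
  if d = ⊤ then 0 else I.f d.toNat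

/-- The utility of agent `i` in the assignment `a`. -/
noncomputable def utility (I : TDG K) (a : Fin I.n ↪ Fin I.m) (i : Fin I.n) : K :=
  ∑ j ∈ Finset.univ.erase i, I.u i j * I.factor (I.G.edist (a i) (a j))

/-- The assignment `a` is individually rational. -/
def IsIR (I : TDG K) (a : Fin I.n ↪ Fin I.m) : Prop :=
  ∀ i, 0 ≤ I.utility a i

/-- The instance is a yes-instance: it has an individually rational assignment. -/
def HasIRAssignment (I : TDG K) : Prop :=
  ∃ a : Fin I.n ↪ Fin I.m, I.IsIR a

/-- Agent `j` is an enemy of agent `i`: there is an arc from `i` to `j` in the enmity graph. -/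
def Enemy (I : TDG K) (i j : Fin I.n) : Prop :=
  I.u i j < 0

/-- At most one agent assigns negative utility to other agents. -/
def AtMostOneHasEnemies (I : TDG K) : Prop :=
  {i : Fin I.n | ∃ j, I.Enemy i j}.Subsingleton

end TDG

/-! ## Random access machine programs with a cost semantics

The memory consists of arrays of natural numbers (for indices and combinatorial data) and arrays of
elements of `K` (for utilities and distance factors), all of unbounded length.  A program is a
finite syntactic object that does not depend on `K` or on the input.  The cost is measured
relative to a size function `sz : K → ℕ`; natural numbers are always charged by their bit length. -/

/-- Expressions with values in the natural numbers. -/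
inductive IdxExp : Type
  | const (c : ℕ)
  /-- the entry of the array number `arr` at the position given by the expression -/
  | read (arr : ℕ) (pos : IdxExp)
  | add (x y : IdxExp)
  /-- truncated subtraction -/
  | sub (x y : IdxExp)
  | mul (x y : IdxExp)

/-- Expressions with values in `K`. -/
inductive NumExp : Type
  | zero
  | one
  | read (arr : ℕ) (pos : IdxExp)
  | add (x y : NumExp)
  | sub (x y : NumExp)
  | mul (x y : NumExp)

/-- Tests. -/
inductive Test : Type
  | idxLe (x y : IdxExp)
  | numLe (x y : NumExp)
  | not (b : Test)
  | and (b c : Test)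

/-- Programs. -/
inductive Prog : Type
  | skip
  | setIdx (arr : ℕ) (pos : IdxExp) (val : IdxExp)
  | setNum (arr : ℕ) (pos : IdxExp) (val : NumExp)
  | seq (p q : Prog)
  | ite (b : Test) (p q : Prog)
  | while (b : Test) (p : Prog)

/-- Memory contents: `idx arr k` and `num arr k` are the entries at position `k` of the array
number `arr`. -/
structure Memory (K : Type) where
  idx : ℕ → ℕ → ℕ
  num : ℕ → ℕ → K

namespace Memory

variable {K : Type}

def setIdx (s : Memory K) (arr k v : ℕ) : Memory K :=
  { s with idx := Function.update s.idx arr (Function.update (s.idx arr) k v) }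

def setNum (s : Memory K) (arr k : ℕ) (v : K) : Memory K :=
  { s with num := Function.update s.num arr (Function.update (s.num arr) k v) }

end Memory

section Semantics

variable {K : Type} [Field K] [LinearOrder K]

def IdxExp.eval (s : Memory K) : IdxExp → ℕ
  | .const c => c
  | .read arr pos => s.idx arr (pos.eval s)
  | .add x y => x.eval s + y.eval s
  | .sub x y => x.eval s - y.eval s
  | .mul x y => x.eval s * y.eval s

/-- Every operation is charged one unit plus the bit length of its result. -/
def IdxExp.cost (s : Memory K) : IdxExp → ℕ
  | .const c => 1 + c.size
  | .read arr pos => pos.cost s + (1 + (s.idx arr (pos.eval s)).size)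
  | .add x y => x.cost s + y.cost s + (1 + (x.eval s + y.eval s).size)
  | .sub x y => x.cost s + y.cost s + (1 + (x.eval s - y.eval s).size)
  | .mul x y => x.cost s + y.cost s + (1 + (x.eval s * y.eval s).size)

def NumExp.eval (s : Memory K) : NumExp → K
  | .zero => 0
  | .one => 1
  | .read arr pos => s.num arr (pos.eval s)
  | .add x y => x.eval s + y.eval s
  | .sub x y => x.eval s - y.eval s
  | .mul x y => x.eval s * y.eval s

/-- Every operation is charged one unit plus the size of its result. -/
def NumExp.cost (sz : K → ℕ) (s : Memory K) : NumExp → ℕ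
  | .zero => 1 + sz 0
  | .one => 1 + sz 1
  | .read arr pos => pos.cost s + (1 + sz (s.num arr (pos.eval s)))
  | .add x y => x.cost sz s + y.cost sz s + (1 + sz (x.eval s + y.eval s))
  | .sub x y => x.cost sz s + y.cost sz s + (1 + sz (x.eval s - y.eval s))
  | .mul x y => x.cost sz s + y.cost sz s + (1 + sz (x.eval s * y.eval s))

def Test.Holds (s : Memory K) : Test → Prop
  | .idxLe x y => x.eval s ≤ y.eval s
  | .numLe x y => x.eval s ≤ y.eval s
  | .not b => ¬ b.Holds s
  | .and b c => b.Holds s ∧ c.Holds s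

def Test.cost (sz : K → ℕ) (s : Memory K) : Test → ℕ
  | .idxLe x y => x.cost s + y.cost s + 1
  | .numLe x y => x.cost sz s + y.cost sz s + 1
  | .not b => b.cost sz s + 1
  | .and b c => b.cost sz s + c.cost sz s + 1

/-- `Exec sz p s t s'`: the program `p`, started in the memory `s`, halts with the memory `s'`
after a run of total cost `t`. -/
inductive Exec (sz : K → ℕ) : Prog → Memory K → ℕ → Memory K → Prop
  | skip (s : Memory K) : Exec sz .skip s 1 s
  | setIdx (arr : ℕ) (pos val : IdxExp) (s : Memory K) :
      Exec sz (.setIdx arr pos val) s (pos.cost s + val.cost s + 1)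
        (s.setIdx arr (pos.eval s) (val.eval s))
  | setNum (arr : ℕ) (pos : IdxExp) (val : NumExp) (s : Memory K) :
      Exec sz (.setNum arr pos val) s (pos.cost s + val.cost sz s + 1)
        (s.setNum arr (pos.eval s) (val.eval s))
  | seq {p q : Prog} {s s₁ s₂ : Memory K} {t₁ t₂ : ℕ} :
      Exec sz p s t₁ s₁ → Exec sz q s₁ t₂ s₂ → Exec sz (.seq p q) s (t₁ + t₂) s₂
  | ite_true {b : Test} {p q : Prog} {s s₁ : Memory K} {t : ℕ} :
      b.Holds s → Exec sz p s t s₁ → Exec sz (.ite b p q) s (b.cost sz s + t + 1) s₁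
  | ite_false {b : Test} {p q : Prog} {s s₁ : Memory K} {t : ℕ} :
      ¬ b.Holds s → Exec sz q s t s₁ → Exec sz (.ite b p q) s (b.cost sz s + t + 1) s₁
  | while_true {b : Test} {p : Prog} {s s₁ s₂ : Memory K} {t₁ t₂ : ℕ} :
      b.Holds s → Exec sz p s t₁ s₁ → Exec sz (.while b p) s₁ t₂ s₂ →
        Exec sz (.while b p) s (b.cost sz s + t₁ + t₂ + 1) s₂
  | while_false {b : Test} {p : Prog} {s : Memory K} :
      ¬ b.Holds s → Exec sz (.while b p) s (b.cost sz s + 1) s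

/-- Runs are deterministic, so the outcome and the cost of a halting run are well defined. -/
theorem Exec.deterministic {sz : K → ℕ} {p : Prog} {s s₁ s₂ : Memory K} {t₁ t₂ : ℕ}
    (h₁ : Exec sz p s t₁ s₁) (h₂ : Exec sz p s t₂ s₂) : t₁ = t₂ ∧ s₁ = s₂ := by
  induction h₁ generalizing t₂ s₂ with
  | skip => cases h₂; exact ⟨rfl, rfl⟩
  | setIdx => cases h₂; exact ⟨rfl, rfl⟩
  | setNum => cases h₂; exact ⟨rfl, rfl⟩
  | seq _ _ ih₁ ih₂ =>
    cases h₂ with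
    | seq a b =>
      obtain ⟨rfl, rfl⟩ := ih₁ a
      obtain ⟨rfl, rfl⟩ := ih₂ b
      exact ⟨rfl, rfl⟩
  | ite_true hb _ ih =>
    cases h₂ with
    | ite_true _ a => obtain ⟨rfl, rfl⟩ := ih a; exact ⟨rfl, rfl⟩
    | ite_false hb' _ => exact absurd hb hb'
  | ite_false hb _ ih =>
    cases h₂ with
    | ite_true hb' _ => exact absurd hb' hb
    | ite_false _ a => obtain ⟨rfl, rfl⟩ := ih a; exact ⟨rfl, rfl⟩
  | while_true hb _ _ ih₁ ih₂ =>
    cases h₂ with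
    | while_true _ a b =>
      obtain ⟨rfl, rfl⟩ := ih₁ a
      obtain ⟨rfl, rfl⟩ := ih₂ b
      exact ⟨rfl, rfl⟩
    | while_false hb' => exact absurd hb hb'
  | while_false hb =>
    cases h₂ with
    | while_true hb' _ _ => exact absurd hb' hb
    | while_false _ => exact ⟨rfl, rfl⟩

/-! ## Input, output and polynomial time -/

open Classical in
/-- The input of a program on the instance `I`.  Natural number arrays: the numbers of agents and of
vertices at positions `0` and `1` of array `0`, the adjacency matrix, row by row, in array `1`.
Number arrays: the utility matrix, row by row, in array `0`, and `f d` for `1 ≤ d < m` in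
array `1`.  (No other finite positive distance occurs between vertices.)  Everything else is `0`. -/
noncomputable def TDG.input (I : TDG K) : Memory K where
  idx arr k :=
    if arr = 0 then
      if k = 0 then I.n else if k = 1 then I.m else 0
    else if arr = 1 then
      if h : k < I.m * I.m then
        if I.G.Adj (Fin.divNat ⟨k, h⟩) (Fin.modNat ⟨k, h⟩) then 1 else 0
      else 0
    else 0
  num arr k :=
    if arr = 0 then
      if h : k < I.n * I.n then I.u (Fin.divNat ⟨k, h⟩) (Fin.modNat ⟨k, h⟩) else 0
    else if arr = 1 then
      if 1 ≤ k ∧ k < I.m then I.f k else 0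
    else 0

/-- The size of the input, where a number `x : K` counts `sz x`. -/
def TDG.inputSize (sz : K → ℕ) (I : TDG K) : ℕ :=
  I.n + I.m + I.m * I.m + ∑ i, ∑ j, sz (I.u i j) + ∑ d ∈ Finset.Ico 1 I.m, sz (I.f d)

/-- The program answers yes by leaving a `1` at position `0` of natural number array `2`. -/
def Memory.Accepts (s : Memory K) : Prop :=
  s.idx 2 0 = 1

/-- On all instances satisfying `C`, the program `p` decides in polynomial time, with respect to
the size function `sz`, whether there is an individually rational assignment. -/
def Prog.DecidesIRInPolyTime (sz : K → ℕ) (p : Prog) (C : TDG K → Prop) : Prop :=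
  ∃ q : Polynomial ℕ, ∀ I : TDG K, C I →
    ∃ (t : ℕ) (s : Memory K), Exec sz p I.input t s ∧ t ≤ q.eval (I.inputSize sz) ∧
      (s.Accepts ↔ I.HasIRAssignment)

end Semantics

/-- Unit size of real numbers, as in the real RAM model. -/
def unitSize (_ : ℝ) : ℕ := 1

/-- Bit length of a rational number, as a sign bit and a reduced fraction in binary. -/
def bitSize (x : ℚ) : ℕ :=
  1 + x.num.natAbs.size + x.den.size

/-! ## Bounds on the running time, and a calculus for halting runs -/

/-! An agent without enemies has nonnegative utility in every assignment, since all distance factors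
are nonnegative. So only the exceptional agent `p` matters, and an individually rational assignment
exists if and only if `p` can be given nonnegative utility. Once the vertex `v` of `p` is fixed, the
best placement of the others is an instance of the rearrangement inequality: pad the agents with `m
- n` dummies of utility `0`, one for each empty vertex, sort them by decreasing utility for `p`, and
put them on the vertices sorted by increasing distance from `v`. Trying every `v` decides the
problem (`permUtility_le`, `utility_le_value`, `exists_utility_eq_value`, `hasIRAssignment_iff`).

No sorting is performed by the program. Ranks and distances are obtained by counting: the rank of an
agent is the number of agents and dummies before it, and the distance of the vertex of rank `r` is
the number of radii `t < m` whose ball around `v` has at most `r` elements (`keyRank_agentKey`,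
`slotDist_keyRank`). Balls are read off a table of the relations "distance less than `t`", filled by
recursion on `t` (`near_succ`).

For the running time, suppose that all stored numbers, all results of arithmetic in `K` and all
iteration counts are bounded by `B`. Intermediate indices are then polynomial in `B`, because the
program is fixed, and so is the total cost. On the real RAM such a `B` is immediate. For rationals,
all partial sums for one agent are fractions over a single common denominator, the product of the
denominators of its utilities and of the factors, whose bit length is linear in the input size;
hence `B` can be taken linear (`isFrac_util_mul_fac`, `sizeBound_bitSize`). -/

theorem Nat.size_le_self (n : ℕ) : n.size ≤ n :=
  Nat.size_le.2 Nat.lt_two_pow_self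

/-- A bound for the value of an expression in a memory with entries at most `B`. -/
def IdxExp.valBound (B : ℕ) : IdxExp → ℕ
  | .const c => c
  | .read _ _ => B
  | .add x y => x.valBound B + y.valBound B
  | .sub x _ => x.valBound B
  | .mul x y => x.valBound B * y.valBound B

/-- A bound for the cost of an expression in a memory with entries at most `B`. -/
def IdxExp.costBound (B : ℕ) : IdxExp → ℕ
  | .const c => 1 + c
  | .read _ pos => pos.costBound B + (1 + B)
  | .add x y => x.costBound B + y.costBound B + (1 + (x.valBound B + y.valBound B))
  | .sub x y => x.costBound B + y.costBound B + (1 + x.valBound B)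
  | .mul x y => x.costBound B + y.costBound B + (1 + x.valBound B * y.valBound B)

/-- A bound for the cost of an expression all of whose subexpressions have values of size at most
`B`. -/
def NumExp.costBound (B : ℕ) : NumExp → ℕ
  | .zero => 1 + B
  | .one => 1 + B
  | .read _ pos => pos.costBound B + (1 + B)
  | .add x y => x.costBound B + y.costBound B + (1 + B)
  | .sub x y => x.costBound B + y.costBound B + (1 + B)
  | .mul x y => x.costBound B + y.costBound B + (1 + B)

def Test.costBound (B : ℕ) : Test → ℕ
  | .idxLe x y => x.costBound B + y.costBound B + 1
  | .numLe x y => x.costBound B + y.costBound B + 1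
  | .not b => b.costBound B + 1
  | .and b c => b.costBound B + c.costBound B + 1

/-- A bound for the cost of a run in which all memory entries are bounded by `B` and no loop is
iterated more than `B` times. -/
def Prog.costBound (B : ℕ) : Prog → ℕ
  | .skip => 1
  | .setIdx _ pos val => pos.costBound B + val.costBound B + 1
  | .setNum _ pos val => pos.costBound B + val.costBound B + 1
  | .seq p q => p.costBound B + q.costBound B
  | .ite b p q => b.costBound B + (p.costBound B + q.costBound B) + 1
  | .while b p => (B + 1) * (b.costBound B + p.costBound B + 1)

/-- A function bounded by a polynomial. -/
def PolyBounded (T : ℕ → ℕ) : Prop :=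
  ∃ q : Polynomial ℕ, ∀ B, T B ≤ q.eval B

namespace PolyBounded

theorem const (c : ℕ) : PolyBounded fun _ => c := ⟨.C c, by simp⟩

theorem id : PolyBounded fun B => B := ⟨.X, by simp⟩

theorem add {S T : ℕ → ℕ} : PolyBounded S → PolyBounded T → PolyBounded fun B => S B + T B
  | ⟨p, hp⟩, ⟨q, hq⟩ => ⟨p + q, fun B => by simpa using add_le_add (hp B) (hq B)⟩

theorem mul {S T : ℕ → ℕ} : PolyBounded S → PolyBounded T → PolyBounded fun B => S B * T B
  | ⟨p, hp⟩, ⟨q, hq⟩ => ⟨p * q, fun B => by simpa using Nat.mul_le_mul (hp B) (hq B)⟩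

end PolyBounded

theorem IdxExp.polyBounded_valBound (e : IdxExp) : PolyBounded fun B => e.valBound B := by
  induction e with
  | const c => exact .const c
  | read => exact PolyBounded.id
  | add _ _ hx hy => exact hx.add hy
  | sub _ _ hx => exact hx
  | mul _ _ hx hy => exact hx.mul hy

theorem IdxExp.polyBounded_costBound (e : IdxExp) : PolyBounded fun B => e.costBound B := by
  have h1 : PolyBounded fun _ => 1 := .const 1
  induction e with
  | const c => exact h1.add (PolyBounded.const c)
  | read _ _ h => exact h.add (h1.add PolyBounded.id)
  | add x y hx hy =>
    exact (hx.add hy).add (h1.add (x.polyBounded_valBound.add y.polyBounded_valBound))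
  | sub x y hx hy => exact (hx.add hy).add (h1.add x.polyBounded_valBound)
  | mul x y hx hy =>
    exact (hx.add hy).add (h1.add (x.polyBounded_valBound.mul y.polyBounded_valBound))

theorem NumExp.polyBounded_costBound (e : NumExp) : PolyBounded fun B => e.costBound B := by
  have h1 : PolyBounded fun B => 1 + B := (PolyBounded.const 1).add PolyBounded.id
  induction e with
  | zero => exact h1
  | one => exact h1
  | read _ pos => exact pos.polyBounded_costBound.add h1
  | add _ _ hx hy => exact (hx.add hy).add h1
  | sub _ _ hx hy => exact (hx.add hy).add h1
  | mul _ _ hx hy => exact (hx.add hy).add h1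

theorem Test.polyBounded_costBound (b : Test) : PolyBounded fun B => b.costBound B := by
  have h1 : PolyBounded fun _ => 1 := .const 1
  induction b with
  | idxLe x y => exact (x.polyBounded_costBound.add y.polyBounded_costBound).add h1
  | numLe x y => exact (x.polyBounded_costBound.add y.polyBounded_costBound).add h1
  | not _ h => exact h.add h1
  | and _ _ hb hc => exact (hb.add hc).add h1

theorem Prog.polyBounded_costBound : ∀ p : Prog, PolyBounded fun B => p.costBound B
  | .skip => .const 1
  | .setIdx _ x y => (x.polyBounded_costBound.add y.polyBounded_costBound).add (.const 1)
  | .setNum _ x y => (x.polyBounded_costBound.add y.polyBounded_costBound).add (.const 1)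
  | .seq p q => p.polyBounded_costBound.add q.polyBounded_costBound
  | .ite b p q =>
    (b.polyBounded_costBound.add (p.polyBounded_costBound.add q.polyBounded_costBound)).add
      (.const 1)
  | .while b p =>
    (PolyBounded.id.add (.const 1)).mul
      ((b.polyBounded_costBound.add p.polyBounded_costBound).add (.const 1))

/-- The natural number arrays that a program may change. -/
def Prog.idxWrites : Prog → List ℕ
  | .skip => []
  | .setIdx arr _ _ => [arr]
  | .setNum _ _ _ => []
  | .seq p q => p.idxWrites ++ q.idxWrites
  | .ite _ p q => p.idxWrites ++ q.idxWrites
  | .while _ p => p.idxWrites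

/-- The number arrays that a program may change. -/
def Prog.numWrites : Prog → List ℕ
  | .skip => []
  | .setIdx _ _ _ => []
  | .setNum arr _ _ => [arr]
  | .seq p q => p.numWrites ++ q.numWrites
  | .ite _ p q => p.numWrites ++ q.numWrites
  | .while _ p => p.numWrites

/-! ### Memory updates, frames and bounded memories -/

namespace Memory

variable {K : Type}

theorem setIdx_idx (s : Memory K) (arr k v a l : ℕ) :
    (s.setIdx arr k v).idx a l = if a = arr ∧ l = k then v else s.idx a l := by
  by_cases ha : a = arr
  · subst ha
    by_cases hl : l = k <;> simp [setIdx, hl]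
  · simp [setIdx, ha]

theorem setNum_num (s : Memory K) (arr k : ℕ) (v : K) (a l : ℕ) :
    (s.setNum arr k v).num a l = if a = arr ∧ l = k then v else s.num a l := by
  by_cases ha : a = arr
  · subst ha
    by_cases hl : l = k <;> simp [setNum, hl]
  · simp [setNum, ha]

@[simp] theorem setIdx_idx_self (s : Memory K) (arr k v : ℕ) :
    (s.setIdx arr k v).idx arr k = v := by simp [setIdx_idx]

theorem setIdx_idx_of_ne (s : Memory K) {arr a : ℕ} (h : a ≠ arr) (k v : ℕ) :
    (s.setIdx arr k v).idx a = s.idx a := by simp [setIdx, h]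

theorem setNum_num_of_ne (s : Memory K) {arr a : ℕ} (h : a ≠ arr) (k : ℕ) (v : K) :
    (s.setNum arr k v).num a = s.num a := by simp [setNum, h]

/-- The memory `s'` agrees with `s` on all arrays that `p` does not write to. -/
structure Frame (p : Prog) (s s' : Memory K) : Prop where
  idx : ∀ a ∉ p.idxWrites, s'.idx a = s.idx a
  num : ∀ a ∉ p.numWrites, s'.num a = s.num a

theorem Frame.refl (p : Prog) (s : Memory K) : Frame p s s := ⟨fun _ _ => rfl, fun _ _ => rfl⟩

theorem Frame.trans {p : Prog} {s s₁ s₂ : Memory K} (h : Frame p s s₁) (h' : Frame p s₁ s₂) :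
    Frame p s s₂ :=
  ⟨fun a ha => (h'.idx a ha).trans (h.idx a ha), fun a ha => (h'.num a ha).trans (h.num a ha)⟩

theorem Frame.mono {p q : Prog} {s s' : Memory K} (h : Frame p s s')
    (hi : p.idxWrites ⊆ q.idxWrites) (hn : p.numWrites ⊆ q.numWrites) : Frame q s s' :=
  ⟨fun a ha => h.idx a fun h' => ha (hi h'), fun a ha => h.num a fun h' => ha (hn h')⟩

/-- All entries of the memory are bounded by `B`. -/
structure Bounded (sz : K → ℕ) (B : ℕ) (s : Memory K) : Prop where
  idx : ∀ a k, s.idx a k ≤ B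
  num : ∀ a k, sz (s.num a k) ≤ B

theorem Bounded.setIdx {sz : K → ℕ} {B : ℕ} {s : Memory K} (h : s.Bounded sz B) (arr k : ℕ)
    {v : ℕ} (hv : v ≤ B) : (s.setIdx arr k v).Bounded sz B :=
  ⟨fun a l => by rw [setIdx_idx]; split_ifs; exacts [hv, h.idx a l], h.num⟩

theorem Bounded.setNum {sz : K → ℕ} {B : ℕ} {s : Memory K} (h : s.Bounded sz B) (arr k : ℕ)
    {v : K} (hv : sz v ≤ B) : (s.setNum arr k v).Bounded sz B :=
  ⟨h.idx, fun a l => by rw [setNum_num]; split_ifs; exacts [hv, h.num a l]⟩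

end Memory

/-! ### Soundness of the cost bounds, and rules for halting runs -/

section Calculus

variable {K : Type} {sz : K → ℕ} {B : ℕ} {s : Memory K}

theorem IdxExp.eval_le (h : s.Bounded sz B) (e : IdxExp) : e.eval s ≤ e.valBound B := by
  induction e with
  | const c => exact le_rfl
  | read => exact h.idx _ _
  | add _ _ hx hy => exact add_le_add hx hy
  | sub _ _ hx => exact (Nat.sub_le _ _).trans hx
  | mul _ _ hx hy => exact Nat.mul_le_mul hx hy

theorem IdxExp.cost_le (h : s.Bounded sz B) (e : IdxExp) : e.cost s ≤ e.costBound B := by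
  induction e with
  | const c => exact Nat.add_le_add_left (Nat.size_le_self c) 1
  | read _ _ hp =>
    exact add_le_add hp (Nat.add_le_add_left ((Nat.size_le_self _).trans (h.idx _ _)) 1)
  | add x y hx hy =>
    exact add_le_add (add_le_add hx hy) (Nat.add_le_add_left
      ((Nat.size_le_self _).trans (add_le_add (x.eval_le h) (y.eval_le h))) 1)
  | sub x y hx hy =>
    exact add_le_add (add_le_add hx hy) (Nat.add_le_add_left
      ((Nat.size_le_self _).trans ((Nat.sub_le _ _).trans (x.eval_le h))) 1)
  | mul x y hx hy =>
    exact add_le_add (add_le_add hx hy) (Nat.add_le_add_left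
      ((Nat.size_le_self _).trans (Nat.mul_le_mul (x.eval_le h) (y.eval_le h))) 1)

variable [Field K]

/-- All results of arithmetic operations in the evaluation of the expression have size at most
`B`. -/
def NumExp.Small (sz : K → ℕ) (B : ℕ) (s : Memory K) : NumExp → Prop
  | .zero => sz 0 ≤ B
  | .one => sz 1 ≤ B
  | .read _ _ => True
  | .add x y => x.Small sz B s ∧ y.Small sz B s ∧ sz (x.eval s + y.eval s) ≤ B
  | .sub x y => x.Small sz B s ∧ y.Small sz B s ∧ sz (x.eval s - y.eval s) ≤ B
  | .mul x y => x.Small sz B s ∧ y.Small sz B s ∧ sz (x.eval s * y.eval s) ≤ B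

def Test.Small (sz : K → ℕ) (B : ℕ) (s : Memory K) : Test → Prop
  | .idxLe _ _ => True
  | .numLe x y => x.Small sz B s ∧ y.Small sz B s
  | .not b => b.Small sz B s
  | .and b c => b.Small sz B s ∧ c.Small sz B s

theorem NumExp.sz_eval_le (h : s.Bounded sz B) {e : NumExp} (he : e.Small sz B s) :
    sz (e.eval s) ≤ B := by
  cases e with
  | zero => exact he
  | one => exact he
  | read => exact h.num _ _
  | add => exact he.2.2
  | sub => exact he.2.2
  | mul => exact he.2.2

theorem NumExp.cost_le (h : s.Bounded sz B) {e : NumExp} (he : e.Small sz B s) :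
    e.cost sz s ≤ e.costBound B := by
  induction e with
  | zero => exact Nat.add_le_add_left he 1
  | one => exact Nat.add_le_add_left he 1
  | read _ pos => exact add_le_add (pos.cost_le h) (Nat.add_le_add_left (h.num _ _) 1)
  | add x y hx hy =>
    exact add_le_add (add_le_add (hx he.1) (hy he.2.1)) (Nat.add_le_add_left he.2.2 1)
  | sub x y hx hy =>
    exact add_le_add (add_le_add (hx he.1) (hy he.2.1)) (Nat.add_le_add_left he.2.2 1)
  | mul x y hx hy =>
    exact add_le_add (add_le_add (hx he.1) (hy he.2.1)) (Nat.add_le_add_left he.2.2 1)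

theorem Test.cost_le (h : s.Bounded sz B) {b : Test} (hb : b.Small sz B s) :
    b.cost sz s ≤ b.costBound B := by
  induction b with
  | idxLe x y => exact Nat.succ_le_succ (add_le_add (x.cost_le h) (y.cost_le h))
  | numLe x y =>
    exact Nat.succ_le_succ (add_le_add (NumExp.cost_le h hb.1) (NumExp.cost_le h hb.2))
  | not _ hi => exact Nat.succ_le_succ (hi hb)
  | and _ _ hi hj => exact Nat.succ_le_succ (add_le_add (hi hb.1) (hj hb.2))

variable [LinearOrder K]

/-- Reduces the preservation of data by a subprogram to non-membership in a concrete list of array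
numbers, which `decide` settles. -/
theorem Exec.frame {p : Prog} {s s' : Memory K} {t : ℕ} (h : Exec sz p s t s') :
    Memory.Frame p s s' := by
  induction h with
  | skip => exact .refl _ _
  | setIdx arr pos val s =>
    exact ⟨fun a ha => s.setIdx_idx_of_ne (by simpa [Prog.idxWrites] using ha) _ _,
      fun _ _ => rfl⟩
  | setNum arr pos val s =>
    exact ⟨fun _ _ => rfl,
      fun a ha => s.setNum_num_of_ne (by simpa [Prog.numWrites] using ha) _ _⟩
  | seq _ _ h₁ h₂ =>
    exact (h₁.mono (List.subset_append_left _ _) (List.subset_append_left _ _)).trans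
      (h₂.mono (List.subset_append_right _ _) (List.subset_append_right _ _))
  | ite_true _ _ h => exact h.mono (List.subset_append_left _ _) (List.subset_append_left _ _)
  | ite_false _ _ h => exact h.mono (List.subset_append_right _ _) (List.subset_append_right _ _)
  | while_true _ _ _ h₁ h₂ =>
    exact Memory.Frame.trans (h₁.mono (List.Subset.refl _) (List.Subset.refl _)) h₂
  | while_false => exact .refl _ _

/-- The program `p`, started in `s`, halts within its cost bound in a bounded memory
satisfying `Q`. -/
def Runs (sz : K → ℕ) (B : ℕ) (p : Prog) (s : Memory K) (Q : Memory K → Prop) : Prop :=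
  ∃ t s', Exec sz p s t s' ∧ t ≤ p.costBound B ∧ s'.Bounded sz B ∧ Q s'

namespace Runs

variable {p q : Prog} {b : Test} {Q R : Memory K → Prop}

theorem imp (h : Runs sz B p s Q) (hQ : ∀ s', s'.Bounded sz B → s.Frame p s' → Q s' → R s') :
    Runs sz B p s R := by
  obtain ⟨t, s', he, ht, hs, hq⟩ := h
  exact ⟨t, s', he, ht, hs, hQ s' hs he.frame hq⟩

theorem skip (hs : s.Bounded sz B) (hQ : Q s) : Runs sz B .skip s Q :=
  ⟨1, s, .skip s, le_rfl, hs, hQ⟩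

theorem setIdx (hs : s.Bounded sz B) {arr : ℕ} {pos val : IdxExp} (hv : val.eval s ≤ B)
    (hQ : Q (s.setIdx arr (pos.eval s) (val.eval s))) : Runs sz B (.setIdx arr pos val) s Q :=
  ⟨_, _, .setIdx arr pos val s,
    Nat.succ_le_succ (add_le_add (pos.cost_le hs) (val.cost_le hs)), hs.setIdx _ _ hv, hQ⟩

theorem setNum (hs : s.Bounded sz B) {arr : ℕ} {pos : IdxExp} {val : NumExp}
    (hv : val.Small sz B s) (hQ : Q (s.setNum arr (pos.eval s) (val.eval s))) :
    Runs sz B (.setNum arr pos val) s Q :=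
  ⟨_, _, .setNum arr pos val s,
    Nat.succ_le_succ (add_le_add (pos.cost_le hs) (NumExp.cost_le hs hv)),
    hs.setNum _ _ (NumExp.sz_eval_le hs hv), hQ⟩

theorem seq (h : Runs sz B p s fun s' => Runs sz B q s' Q) : Runs sz B (.seq p q) s Q := by
  obtain ⟨t₁, s₁, h₁, ht₁, -, t₂, s₂, h₂, ht₂, hs₂, hQ⟩ := h
  exact ⟨_, s₂, h₁.seq h₂, add_le_add ht₁ ht₂, hs₂, hQ⟩

theorem ite (hs : s.Bounded sz B) (hb : b.Small sz B s) (hp : b.Holds s → Runs sz B p s Q)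
    (hq : ¬ b.Holds s → Runs sz B q s Q) : Runs sz B (.ite b p q) s Q := by
  have hc := Test.cost_le hs hb
  by_cases h : b.Holds s
  · obtain ⟨t, s', he, ht, hs', hQ⟩ := hp h
    exact ⟨_, s', .ite_true h he, by simp only [Prog.costBound]; omega, hs', hQ⟩
  · obtain ⟨t, s', he, ht, hs', hQ⟩ := hq h
    exact ⟨_, s', .ite_false h he, by simp only [Prog.costBound]; omega, hs', hQ⟩

end Runs

/-- The value of a variable, which is position `0` of an array. -/
abbrev IdxExp.var (c : ℕ) : IdxExp := .read c (.const 0)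

abbrev Prog.setVar (c : ℕ) (val : IdxExp) : Prog := .setIdx c (.const 0) val

/-- Increase the variable `c` by one. -/
abbrev Prog.incr (c : ℕ) : Prog := .setVar c (.add (.var c) (.const 1))

/-- The loop with the variable `c` running from `0` up to `bd`, exclusively. -/
def Prog.loop (c : ℕ) (bd : IdxExp) (p : Prog) : Prog :=
  .seq (.setVar c (.const 0)) (.while (.not (.idxLe bd (.var c))) (.seq p (.incr c)))

namespace Runs

variable {p : Prog}

/-- Invariant rule for counting loops. The invariant has to survive writes to the counter because
the loop itself resets and increments it, and the bound has to evaluate to `N` in every memory that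
the loop can reach. -/
theorem loop {c N : ℕ} {bd : IdxExp} (J : ℕ → Memory K → Prop) (hs : s.Bounded sz B) (hN : N ≤ B)
    (hc : c ∉ p.idxWrites) (hbd : ∀ s', s.Frame (.loop c bd p) s' → bd.eval s' = N) (h0 : J 0 s)
    (hJ : ∀ k s' v, J k s' → J k (s'.setIdx c 0 v))
    (step : ∀ k < N, ∀ s', s'.Bounded sz B → s.Frame (.loop c bd p) s' → s'.idx c 0 = k → J k s' →
      Runs sz B p s' (J (k + 1))) :
    Runs sz B (.loop c bd p) s (J N) := by
  have hset : ∀ s' : Memory K, ∀ v, s'.Frame (.loop c bd p) (s'.setIdx c 0 v) := fun s' v =>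
    ⟨fun a ha => s'.setIdx_idx_of_ne (fun h => ha (by simp [h, Prog.loop, Prog.idxWrites])) _ _,
      fun _ _ => rfl⟩
  set b : Test := .not (.idxLe bd (.var c)) with hb
  -- Induction on the number `r` of remaining iterations; the final summand pays for the failing
  -- test.
  have main : ∀ r k s', k + r = N → s'.Bounded sz B → s.Frame (.loop c bd p) s' →
      s'.idx c 0 = k → J k s' →
      ∃ t s'', Exec sz (.while b (.seq p (.incr c))) s' t s'' ∧
        t ≤ r * (b.costBound B + (Prog.seq p (.incr c)).costBound B + 1) + b.costBound B + 1 ∧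
        s''.Bounded sz B ∧ J N s'' := by
    intro r
    induction r with
    | zero =>
      intro k s' hk hs' hf hck hJk
      have hfalse : ¬ b.Holds s' := by
        simp [hb, Test.Holds, hbd s' hf, IdxExp.eval, hck]
        omega
      refine ⟨_, s', .while_false hfalse, ?_, hs', ?_⟩
      · have := Test.cost_le hs' (b := b) trivial
        omega
      · obtain rfl : k = N := by omega
        exact hJk
    | succ r ih =>
      intro k s' hk hs' hf hck hJk
      have htrue : b.Holds s' := by
        simp [hb, Test.Holds, hbd s' hf, IdxExp.eval, hck]
        omega
      have hbody : Runs sz B (.seq p (.incr c)) s' fun s'' =>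
          s''.idx c 0 = k + 1 ∧ J (k + 1) s'' := by
        refine .seq ((step k (by omega) s' hs' hf hck hJk).imp fun s₁ hs₁ hf₁ hJ₁ => ?_)
        have hck₁ : s₁.idx c 0 = k := by rw [hf₁.idx c hc, hck]
        refine .setIdx hs₁ ?_ ?_
        · simp only [IdxExp.eval, hck₁]; omega
        · simp only [IdxExp.eval, hck₁]
          exact ⟨by simp, hJ _ _ _ hJ₁⟩
      obtain ⟨t₁, s₁, he₁, ht₁, hs₁, hck₁, hJ₁⟩ := hbody
      obtain ⟨t₂, s₂, he₂, ht₂, hs₂, hJ₂⟩ := ih (k + 1) s₁ (by omega) hs₁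
        (hf.trans (he₁.frame.mono (by simp [Prog.loop, Prog.idxWrites])
          (by simp [Prog.loop, Prog.numWrites]))) hck₁ hJ₁
      refine ⟨_, s₂, .while_true htrue he₁ he₂, ?_, hs₂, hJ₂⟩
      have := Test.cost_le hs' (b := b) trivial
      rw [add_mul]
      omega
  refine .seq (.setIdx hs (by simp [IdxExp.eval]) ?_)
  simp only [IdxExp.eval]
  obtain ⟨t, s', he, ht, hs', hJN⟩ := main N 0 (s.setIdx c 0 0) (by omega)
    (hs.setIdx _ _ (by omega)) (hset s 0) (by simp) (hJ _ _ _ h0)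
  refine ⟨t, s', he, ht.trans ?_, hs', hJN⟩
  -- The factor `B + 1` in the cost bound of `while` covers `N ≤ B` iterations and the last, failing
  -- test.
  have := Nat.mul_le_mul_right (b.costBound B + (Prog.seq p (.incr c)).costBound B + 1) hN
  change _ ≤ (B + 1) * (b.costBound B + (Prog.seq p (.incr c)).costBound B + 1)
  rw [add_mul]
  omega

end Runs

/-- Count, in the variable `r`, the values of the variable `c` below `bd` for which the test `b`
holds after a run of `p`. -/
def Prog.count (c r : ℕ) (bd : IdxExp) (p : Prog) (b : Test) : Prog :=
  .seq (.setVar r (.const 0)) (.loop c bd (.seq p (.ite b (.incr r) .skip)))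

theorem Runs.count {c r N : ℕ} {bd : IdxExp} {p : Prog} {b : Test} (P : ℕ → Prop)
    [DecidablePred P] (hs : s.Bounded sz B) (hN : N ≤ B) (hc : c ∉ p.idxWrites) (hcr : c ≠ r)
    (hr : r ∉ p.idxWrites) (hbd : ∀ s', s.Frame (.count c r bd p b) s' → bd.eval s' = N)
    (step : ∀ k < N, ∀ s', s'.Bounded sz B → s.Frame (.count c r bd p b) s' → s'.idx c 0 = k →
      Runs sz B p s' fun s'' => b.Small sz B s'' ∧ (b.Holds s'' ↔ P k)) :
    Runs sz B (.count c r bd p b) s fun s' => s'.idx r 0 = Nat.count P N := by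
  refine .seq (.setIdx hs (Nat.zero_le _) ?_)
  have hf₀ : s.Frame (.count c r bd p b) (s.setIdx r 0 0) :=
    ⟨fun a ha => s.setIdx_idx_of_ne (fun h => ha (by simp [h, Prog.count, Prog.idxWrites])) _ _,
      fun _ _ => rfl⟩
  have hmono : ∀ s', (s.setIdx r 0 0).Frame (.loop c bd (.seq p (.ite b (.incr r) .skip))) s' →
      s.Frame (.count c r bd p b) s' := fun s' h =>
    hf₀.trans (h.mono (List.subset_append_right _ _) (List.subset_append_right _ _))
  refine .loop (fun k s' => s'.idx r 0 = Nat.count P k) (hs.setIdx _ _ (Nat.zero_le _)) hN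
    ?_ (fun s' h => hbd s' (hmono s' h)) ?_ ?_ ?_
  · simp [Prog.idxWrites, hc, hcr]
  · simp [IdxExp.eval]
  · intro k s' v h
    rw [Memory.setIdx_idx_of_ne _ hcr.symm]
    exact h
  · intro k hk s' hs' hf hck hJ
    refine .seq ((step k hk s' hs' (hmono s' hf) hck).imp fun s₁ hs₁ hf₁ ⟨hsm, hP⟩ => ?_)
    have hr₁ : s₁.idx r 0 = Nat.count P k := by rw [hf₁.idx r hr, hJ]
    have hle := Nat.count_le (p := P) (n := k)
    refine .ite hs₁ hsm (fun h => ?_) (fun h => ?_)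
    · refine .setIdx hs₁ ?_ ?_
      · simp only [IdxExp.eval, hr₁]; omega
      · simp [IdxExp.eval, hr₁, Nat.count_succ, hP.1 h]
    · exact .skip hs₁ (by simp [hr₁, Nat.count_succ, mt hP.2 h])

end Calculus

/-! ## The program -/

theorem Nat.mul_add_div_and_mod {m b : ℕ} (a : ℕ) (hb : b < m) :
    (a * m + b) / m = a ∧ (a * m + b) % m = b :=
  ⟨by rw [mul_comm, Nat.mul_add_div (by omega), Nat.div_eq_of_lt hb, add_zero],
    by rw [mul_comm, Nat.mul_add_mod, Nat.mod_eq_of_lt hb]⟩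

section Program

open Classical

abbrev Test.or (b c : Test) : Test := .not (.and (.not b) (.not c))

abbrev Test.idxEq (x y : IdxExp) : Test := .and (.idxLe x y) (.idxLe y x)

namespace IRProg

abbrev agents : IdxExp := .read 0 (.const 0)

abbrev vertices : IdxExp := .read 0 (.const 1)

abbrev tablePos (t v w : IdxExp) : IdxExp := .add (.mul (.add (.mul t vertices) v) vertices) w

abbrev util (i j : IdxExp) : NumExp := .read 0 (.add (.mul i agents) j)

/-- Fill the array `3`, so that the entry at position `(t * m + v) * m + w` is positive if and only
if the distance between `v` and `w` is less than `t`. -/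
def fillTable : Prog :=
  .loop 4 vertices <| .loop 5 vertices <| .loop 6 vertices <|
    .seq
      (.count 7 8 vertices .skip
        (.and (.idxLe (.const 1) (.read 3 (tablePos (.var 4) (.var 5) (.var 7))))
          (.idxLe (.const 1) (.read 1 (.add (.mul (.var 7) vertices) (.var 6))))))
      -- With truncated subtraction the stored value is `1 - |v - w| * (1 - r)`, where `r` counts
      -- the neighbours of `w` that are near `v`. It is positive exactly if `v = w` or `r > 0`.
      (.setIdx 3 (tablePos (.add (.var 4) (.const 1)) (.var 5) (.var 6))
        (.sub (.const 1) (.mul (.add (.sub (.var 5) (.var 6)) (.sub (.var 6) (.var 5)))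
          (.sub (.const 1) (.var 8)))))

/-- Compute, in the variable `13`, the rank of the agent `11` in the order in which the agent `9`
places the agents, beginning with itself. -/
def computeRank : Prog :=
  .seq
    (.count 12 13 agents .skip
      (.or (.idxEq (.var 12) (.var 9))
        (.and (.numLe (util (.var 9) (.var 11)) (util (.var 9) (.var 12)))
          (.or (.not (.numLe (util (.var 9) (.var 12)) (util (.var 9) (.var 11))))
            (.not (.idxLe (.var 11) (.var 12)))))))
    -- An agent of negative utility is placed after all `m - n` empty vertices, which act as agents
    -- of utility `0`.
    (.ite (.numLe .zero (util (.var 9) (.var 11))) .skip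
      (.setVar 13 (.add (.var 13) (.sub vertices agents))))

/-- Compute, in the variable `17`, the distance from the vertex `10` of the vertex whose rank by
this distance is the value of the variable `13`. -/
def computeSlot : Prog :=
  .count 14 17 vertices
    (.count 15 16 vertices .skip
      (.idxLe (.const 1) (.read 3 (tablePos (.add (.var 14) (.const 1)) (.var 10) (.var 15)))))
    (.idxLe (.var 16) (.var 13))

/-- Compute, at position `0` of the number array `2`, the maximal utility of the agent `9` at the
vertex `10`. -/
def computeValue : Prog :=
  .seq (.setNum 2 (.const 0) .zero)
    (.loop 11 agents <| .seq computeRank <| .seq computeSlot <|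
      .setNum 2 (.const 0) (.add (.read 2 (.const 0))
        (.mul (util (.var 9) (.var 11)) (.read 1 (.var 17)))))

def main : Prog :=
  .seq fillTable <|
    .seq
      (.count 9 19 agents
        (.count 10 18 vertices computeValue (.numLe .zero (.read 2 (.const 0))))
        (.not (.idxLe (.const 1) (.var 18))))
      (.setVar 2 (.sub (.const 1) (.var 19)))

end IRProg

/-! ### Mathematical counterparts of the computed quantities -/

namespace TDG

variable {K : Type} [Field K] [LinearOrder K]

/-- The utility matrix in the input of a program. -/
noncomputable def util (I : TDG K) (i j : ℕ) : K := I.input.num 0 (i * I.n + j)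

/-- The distance factors in the input of a program. -/
noncomputable def fac (I : TDG K) (d : ℕ) : K := I.input.num 1 d

/-- The distance of the vertices `v` and `w` is less than `t`. -/
def Near (I : TDG K) (t v w : ℕ) : Prop :=
  ∃ (hv : v < I.m) (hw : w < I.m), I.G.edist ⟨v, hv⟩ ⟨w, hw⟩ < t

theorem not_near_zero (I : TDG K) (v w : ℕ) : ¬ I.Near 0 v w := by
  simp [Near]

/-- Recursion behind the table of distances: a shortest walk from `v` to `w` is either trivial or
passes through a neighbour of `w` at distance one less from `v`. -/
theorem near_succ (I : TDG K) {t v w : ℕ} (hv : v < I.m) (hw : w < I.m) :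
    I.Near (t + 1) v w ↔
      v = w ∨ ∃ x, ∃ hx : x < I.m, I.Near t v x ∧ I.G.Adj ⟨x, hx⟩ ⟨w, hw⟩ := by
  constructor
  · rintro ⟨_, _, h⟩
    have hle : I.G.edist ⟨v, hv⟩ ⟨w, hw⟩ ≤ t := by
      rw [Nat.cast_add, Nat.cast_one] at h
      exact Order.lt_add_one_iff_of_not_isMax (by simp) |>.1 h
    have hne : I.G.edist ⟨w, hw⟩ ⟨v, hv⟩ ≠ ⊤ := by
      rw [SimpleGraph.edist_comm]
      exact ne_top_of_le_ne_top (ENat.natCast_ne_top t) hle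
    -- The walk is taken from `w` to `v`, so that its first edge exposes the neighbour of `w`.
    obtain ⟨p, hp⟩ := (SimpleGraph.edist_ne_top_iff_reachable.1 hne).exists_walk_length_eq_edist
    cases p with
    | nil => exact .inl rfl
    | cons ha p =>
      rename_i x
      refine .inr ⟨x, x.2, ⟨hv, x.2, ?_⟩, ha.symm⟩
      rw [SimpleGraph.edist_comm]
      refine (SimpleGraph.Walk.edist_le p).trans_lt ?_
      rw [SimpleGraph.edist_comm, ← hp, SimpleGraph.Walk.length_cons] at hle
      exact_mod_cast (Nat.cast_le.1 hle : p.length + 1 ≤ t)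
  · rintro (rfl | ⟨x, hx, ⟨_, _, h⟩, ha⟩)
    · exact ⟨hv, hw, by simp⟩
    · refine ⟨hv, hw, (SimpleGraph.edist_triangle (v := ⟨x, hx⟩)).trans_lt ?_⟩
      rw [SimpleGraph.edist_eq_one_iff_adj.2 ha, Nat.cast_add, Nat.cast_one]
      exact (ENat.add_lt_add_iff_right (by simp)).2 h

/-- The number of vertices at distance at most `t` from `v`. -/
noncomputable def ballCard (I : TDG K) (t v : ℕ) : ℕ := Nat.count (I.Near (t + 1) v) I.m

/-- The agent `k` precedes the agent `j` in the order in which `i` places the agents. -/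
def Before (I : TDG K) (i k j : ℕ) : Prop :=
  k = i ∨ I.util i j ≤ I.util i k ∧ (I.util i j < I.util i k ∨ k < j)

/-- The rank of the agent `j` in the order in which `i` places the agents and the empty vertices. -/
noncomputable def rank (I : TDG K) (i j : ℕ) : ℕ :=
  Nat.count (fun k => I.Before i k j) I.n + if 0 ≤ I.util i j then 0 else I.m - I.n

/-- The distance from `v` of the vertex of rank `r` with respect to this distance, with value `m`
instead of `∞`. -/
noncomputable def slotDist (I : TDG K) (v r : ℕ) : ℕ := Nat.count (fun t => I.ballCard t v ≤ r) I.m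

/-- The maximal utility of the agent `i` at the vertex `v`. -/
noncomputable def value (I : TDG K) (i v : ℕ) : K :=
  ∑ j ∈ Finset.range I.n, I.util i j * I.fac (I.slotDist v (I.rank i j))

@[simp] theorem input_agents (I : TDG K) : I.input.idx 0 0 = I.n := rfl

@[simp] theorem input_vertices (I : TDG K) : I.input.idx 0 1 = I.m := rfl

theorem input_adj (I : TDG K) {x w : ℕ} (hx : x < I.m) (hw : w < I.m) :
    1 ≤ I.input.idx 1 (x * I.m + w) ↔ I.G.Adj ⟨x, hx⟩ ⟨w, hw⟩ := by
  have h : x * I.m + w < I.m * I.m := by nlinarith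
  have h1 : (Fin.divNat ⟨x * I.m + w, h⟩ : Fin I.m) = ⟨x, hx⟩ := by
    ext
    simp [Fin.divNat, Nat.add_div_of_dvd_right (Dvd.intro_left x rfl), Nat.div_eq_of_lt hw,
      Nat.mul_div_cancel _ (Nat.zero_lt_of_lt hw)]
  have h2 : (Fin.modNat ⟨x * I.m + w, h⟩ : Fin I.m) = ⟨w, hw⟩ := by
    ext
    simp [Fin.modNat, Nat.mod_eq_of_lt hw]
  simp only [input, h, dif_pos, h1, h2]
  split_ifs <;> simp_all

theorem util_of_lt (I : TDG K) {i j : ℕ} (hi : i < I.n) (hj : j < I.n) :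
    I.util i j = I.u ⟨i, hi⟩ ⟨j, hj⟩ := by
  have h : i * I.n + j < I.n * I.n := by nlinarith
  have h1 : (Fin.divNat ⟨i * I.n + j, h⟩ : Fin I.n) = ⟨i, hi⟩ := by
    ext
    simp [Fin.divNat, Nat.add_div_of_dvd_right (Dvd.intro_left i rfl), Nat.div_eq_of_lt hj,
      Nat.mul_div_cancel _ (Nat.zero_lt_of_lt hj)]
  have h2 : (Fin.modNat ⟨i * I.n + j, h⟩ : Fin I.n) = ⟨j, hj⟩ := by
    ext
    simp [Fin.modNat, Nat.mod_eq_of_lt hj]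
  simp [util, input, h, h1, h2]

/-- The number `B` bounds the size of all numbers that occur in a run of the program. -/
structure SizeBound (sz : K → ℕ) (B : ℕ) (I : TDG K) : Prop where
  vertices : I.m + 1 ≤ B
  zero : sz 0 ≤ B
  num : ∀ a k, sz (I.input.num a k) ≤ B
  mul : ∀ i < I.n, ∀ j < I.n, ∀ d, sz (I.util i j * I.fac d) ≤ B
  -- The partial sums are the values of the accumulator. Arbitrary distances `d` are allowed, so
  -- that the bound does not depend on the chosen slots.
  sum : ∀ i < I.n, ∀ k ≤ I.n, ∀ d : ℕ → ℕ,
    sz (∑ j ∈ Finset.range k, I.util i j * I.fac (d j)) ≤ B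

theorem SizeBound.bounded_input {sz : K → ℕ} {B : ℕ} {I : TDG K} (h : I.SizeBound sz B) :
    I.input.Bounded sz B := by
  refine ⟨fun a k => ?_, h.num⟩
  have := h.vertices
  have := I.agents_le
  simp only [input]
  split_ifs <;> omega

/-- The memory contains the input. -/
structure HasInput (I : TDG K) (s : Memory K) : Prop where
  idx_zero : s.idx 0 = I.input.idx 0
  idx_one : s.idx 1 = I.input.idx 1
  num_zero : s.num 0 = I.input.num 0
  num_one : s.num 1 = I.input.num 1

theorem HasInput.frame {I : TDG K} {s s' : Memory K} {p : Prog} (h : I.HasInput s)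
    (hf : s.Frame p s') (h0 : 0 ∉ p.idxWrites := by decide) (h1 : 1 ∉ p.idxWrites := by decide)
    (h2 : 0 ∉ p.numWrites := by decide) (h3 : 1 ∉ p.numWrites := by decide) : I.HasInput s' :=
  ⟨(hf.idx 0 h0).trans h.1, (hf.idx 1 h1).trans h.2, (hf.num 0 h2).trans h.3,
    (hf.num 1 h3).trans h.4⟩

/-- The first `e` entries of the table of distances are filled correctly. -/
def HasTable (I : TDG K) (e : ℕ) (s : Memory K) : Prop :=
  ∀ k < e, 1 ≤ s.idx 3 k ↔ I.Near (k / I.m / I.m) (k / I.m % I.m) (k % I.m)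

theorem HasTable.near {I : TDG K} {s : Memory K} {e t v w : ℕ} (h : I.HasTable e s)
    (he : (t * I.m + v) * I.m + w < e) (hv : v < I.m) (hw : w < I.m) :
    1 ≤ s.idx 3 ((t * I.m + v) * I.m + w) ↔ I.Near t v w := by
  rw [h _ he, (Nat.mul_add_div_and_mod _ hw).1, (Nat.mul_add_div_and_mod _ hw).2,
    (Nat.mul_add_div_and_mod t hv).1, (Nat.mul_add_div_and_mod t hv).2]

end TDG
end Program

/-! ### Correctness of the program -/

section Correctness

open Classical

namespace IRProg

open TDG

variable {K : Type} [Field K] [LinearOrder K] {sz : K → ℕ} {B : ℕ} {I : TDG K} {s : Memory K}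

theorem _root_.TDG.HasInput.eval_vertices (h : I.HasInput s) : vertices.eval s = I.m := by
  simp [IdxExp.eval, h.idx_zero]

theorem _root_.TDG.HasInput.eval_agents (h : I.HasInput s) : agents.eval s = I.n := by
  simp [IdxExp.eval, h.idx_zero]

theorem _root_.TDG.HasInput.eval_util (h : I.HasInput s) (x y : IdxExp) :
    (util x y).eval s = I.util (x.eval s) (y.eval s) := by
  simp [NumExp.eval, IdxExp.eval, TDG.util, h.num_zero, h.idx_zero]

theorem _root_.TDG.HasTable.setIdx {e : ℕ} (h : I.HasTable e s) {c : ℕ} (hc : c ≠ 3) (k v : ℕ) :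
    I.HasTable e (s.setIdx c k v) := by
  intro l hl
  rw [Memory.setIdx_idx_of_ne _ hc.symm]
  exact h l hl

theorem _root_.TDG.HasTable.frame {e : ℕ} {s' : Memory K} {p : Prog} (h : I.HasTable e s)
    (hf : s.Frame p s') (h3 : 3 ∉ p.idxWrites := by decide) : I.HasTable e s' := by
  intro l hl
  rw [hf.idx 3 h3]
  exact h l hl

theorem runs_fillTable_step {t v w : ℕ} (hB : I.SizeBound sz B) (hs : s.Bounded sz B)
    (hI : I.HasInput s) (ht : s.idx 4 0 = t) (hv : s.idx 5 0 = v) (hw : s.idx 6 0 = w)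
    (hvm : v < I.m) (hwm : w < I.m) (hT : I.HasTable (((t + 1) * I.m + v) * I.m + w) s) :
    Runs sz B
      (.seq
      (.count 7 8 vertices .skip
        (.and (.idxLe (.const 1) (.read 3 (tablePos (.var 4) (.var 5) (.var 7))))
          (.idxLe (.const 1) (.read 1 (.add (.mul (.var 7) vertices) (.var 6))))))
      (.setIdx 3 (tablePos (.add (.var 4) (.const 1)) (.var 5) (.var 6))
        (.sub (.const 1) (.mul (.add (.sub (.var 5) (.var 6)) (.sub (.var 6) (.var 5)))
          (.sub (.const 1) (.var 8)))))) s
      (I.HasTable (((t + 1) * I.m + v) * I.m + (w + 1))) := by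
  have hm := hB.vertices
  refine .seq ((Runs.count
    (fun x => ∃ hx : x < I.m, I.Near t v x ∧ I.G.Adj ⟨x, hx⟩ ⟨w, hwm⟩) hs
    (by omega : I.m ≤ B) (by decide) (by decide) (by decide)
    (fun s' hf => (hI.frame hf).eval_vertices) ?_).imp ?_)
  · intro x hx s' hs' hf hc
    have hI' := hI.frame hf
    refine .skip hs' ⟨⟨trivial, trivial⟩, ?_⟩
    simp only [Test.Holds, IdxExp.eval, hc, hI'.idx_zero, input_vertices, hI'.idx_one,
      hf.idx 4 (by decide), hf.idx 5 (by decide), hf.idx 6 (by decide), ht, hv, hw,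
      input_adj I hx hwm]
    rw [(hT.frame hf).near _ hvm hx]
    · simp [hx]
    -- The entry read belongs to layer `t` and thus precedes all entries of layer `t + 1`, so it is
    -- already filled.
    · calc (t * I.m + v) * I.m + x < (t * I.m + v) * I.m + I.m := by omega
        _ ≤ (t * I.m + v) * I.m + I.m * I.m :=
          Nat.add_le_add_left (Nat.le_mul_of_pos_left _ (by omega)) _
        _ = ((t + 1) * I.m + v) * I.m := by ring
        _ ≤ _ := Nat.le_add_right _ _
  · intro s' hs' hf hcount
    have hI' := hI.frame hf
    have hT' := hT.frame hf
    refine .setIdx hs' ?_ ?_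
    · simp only [IdxExp.eval]; omega
    · simp only [IdxExp.eval, hI'.idx_zero, input_vertices, hf.idx 4 (by decide),
        hf.idx 5 (by decide), hf.idx 6 (by decide), ht, hv, hw, hcount]
      intro k hk
      rw [Memory.setIdx_idx]
      by_cases hke : k = ((t + 1) * I.m + v) * I.m + w
      · rw [if_pos ⟨rfl, hke⟩, hke, (Nat.mul_add_div_and_mod _ hwm).1,
          (Nat.mul_add_div_and_mod _ hwm).2, (Nat.mul_add_div_and_mod _ hvm).1,
          (Nat.mul_add_div_and_mod _ hvm).2, near_succ I hvm hwm]
        set P : ℕ → Prop := fun x => ∃ hx : x < I.m, I.Near t v x ∧ I.G.Adj ⟨x, hx⟩ ⟨w, hwm⟩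
        have hP : (∃ x, P x) ↔ Nat.count P I.m ≠ 0 := by
          rw [Ne, Nat.count_iff_forall_not]
          push Not
          exact ⟨fun ⟨x, hx⟩ => ⟨x, hx.1, hx⟩, fun ⟨x, _, hx⟩ => ⟨x, hx⟩⟩
        rw [hP]
        generalize Nat.count P I.m = r
        rcases Nat.eq_zero_or_pos r with rfl | h0
        · omega
        · rw [Nat.sub_eq_zero_of_le (show 1 ≤ r from h0)]
          simp [h0.ne']
      · rw [if_neg fun h => hke h.2]
        exact hT' k (by omega)

theorem runs_fillTable (hB : I.SizeBound sz B) :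
    Runs sz B fillTable I.input (I.HasTable ((I.m + 1) * I.m * I.m)) := by
  have hm := hB.vertices
  have hI : I.HasInput I.input := ⟨rfl, rfl, rfl, rfl⟩
  refine .loop (fun t => I.HasTable ((t + 1) * I.m * I.m)) hB.bounded_input
    (by omega : I.m ≤ B) (by decide) (fun s' hf => (hI.frame hf).eval_vertices) ?_
    (fun k s' v h => h.setIdx (by decide) _ _) ?_
  -- Layer `0` is correct from the start: array `3` is initially zero, and no distance is less than
  -- `0`.
  · intro k hk
    have h0 : k / I.m / I.m = 0 := by
      rw [Nat.div_div_eq_div_mul]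
      exact Nat.div_eq_of_lt (by simpa using hk)
    simp only [h0, not_near_zero, iff_false, input]
    simp
  intro t ht s₁ hs₁ hf₁ hc₁ hT₁
  have hI₁ := hI.frame hf₁
  refine (Runs.loop (fun v => I.HasTable (((t + 1) * I.m + v) * I.m)) hs₁
    (by omega : I.m ≤ B) (by decide) (fun s' hf => (hI₁.frame hf).eval_vertices)
    (by simpa using hT₁)
    (fun k s' v h => h.setIdx (by decide) _ _) ?_).imp
      fun s' _ _ h => by convert h using 1; ring
  intro v hv s₂ hs₂ hf₂ hc₂ hT₂
  have hI₂ := hI₁.frame hf₂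
  refine (Runs.loop (fun w => I.HasTable (((t + 1) * I.m + v) * I.m + w)) hs₂
    (by omega : I.m ≤ B) (by decide) (fun s' hf => (hI₂.frame hf).eval_vertices)
    (by simpa using hT₂)
    (fun k s' v h => h.setIdx (by decide) _ _) ?_).imp
      fun s' _ _ h => by convert h using 1; ring
  intro w hw s₃ hs₃ hf₃ hc₃ hT₃
  refine runs_fillTable_step hB hs₃ (hI₂.frame hf₃) ?_ ?_ hc₃ hv hw hT₃
  · rw [hf₃.idx 4 (by decide), hf₂.idx 4 (by decide), hc₁]
  · rw [hf₃.idx 5 (by decide), hc₂]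

/-- The memory contains the input and the table of distances. -/
structure Ready (I : TDG K) (s : Memory K) : Prop extends I.HasInput s where
  table : I.HasTable ((I.m + 1) * I.m * I.m) s

theorem Ready.frame {s' : Memory K} {p : Prog} (h : Ready I s)
    (hf : s.Frame p s') (h0 : 0 ∉ p.idxWrites := by decide) (h1 : 1 ∉ p.idxWrites := by decide)
    (h2 : 0 ∉ p.numWrites := by decide) (h3 : 1 ∉ p.numWrites := by decide)
    (h4 : 3 ∉ p.idxWrites := by decide) : Ready I s' :=
  ⟨h.toHasInput.frame hf h0 h1 h2 h3, h.table.frame hf h4⟩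

theorem runs_computeRank {i j : ℕ} (hB : I.SizeBound sz B) (hs : s.Bounded sz B)
    (hR : Ready I s) (hi : s.idx 9 0 = i) (hj : s.idx 11 0 = j) :
    Runs sz B computeRank s fun s' => s'.idx 13 0 = I.rank i j := by
  have hm := hB.vertices
  have hn := I.agents_le
  refine .seq ((Runs.count (fun k => I.Before i k j) hs
    (by omega : I.n ≤ B) (by decide) (by decide) (by decide)
    (fun s' hf => (hR.frame hf).eval_agents) ?_).imp ?_)
  · intro k hk s' hs' hf hc
    have hR' := hR.frame hf
    refine .skip hs' ⟨by simp [Test.Small, NumExp.Small], ?_⟩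
    simp only [Test.Holds, hR'.eval_util, Before]
    simp only [IdxExp.eval, hc, hf.idx 9 (by decide), hf.idx 11 (by decide), hi, hj,
      le_antisymm_iff]
    rw [← not_le, ← not_le]
    tauto
  · intro s' hs' hf hcount
    have hR' := hR.frame hf
    have hle := Nat.count_le (p := fun k => I.Before i k j) (n := I.n)
    have hu : (NumExp.zero.eval s' ≤ (util (.var 9) (.var 11)).eval s') ↔ 0 ≤ I.util i j := by
      rw [hR'.eval_util]
      simp only [NumExp.eval, IdxExp.eval, hf.idx 9 (by decide), hf.idx 11 (by decide), hi, hj]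
    refine .ite hs' ⟨hB.zero, trivial⟩ (fun h => .skip hs' ?_) (fun h => .setIdx hs' ?_ ?_)
    · rw [rank, hcount, if_pos (hu.1 h), add_zero]
    · simp only [IdxExp.eval, hR'.idx_zero, hcount, input_vertices, input_agents]
      omega
    · simp only [IdxExp.eval, hR'.idx_zero, hcount, input_vertices, input_agents,
        Memory.setIdx_idx_self]
      rw [rank, if_neg (mt hu.2 h)]

theorem runs_computeSlot {v r : ℕ} (hB : I.SizeBound sz B) (hs : s.Bounded sz B)
    (hR : Ready I s) (hv : s.idx 10 0 = v) (hr : s.idx 13 0 = r) (hvm : v < I.m) :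
    Runs sz B computeSlot s fun s' => s'.idx 17 0 = I.slotDist v r := by
  have hm := hB.vertices
  rw [computeSlot]
  refine Runs.count (fun t => I.ballCard t v ≤ r) hs (by omega : I.m ≤ B) (by decide) (by decide)
    (by decide) (fun s' hf => (hR.frame hf).eval_vertices) ?_
  intro t ht s₁ hs₁ hf₁ hc₁
  have hR₁ := hR.frame hf₁
  refine (Runs.count (I.Near (t + 1) v) hs₁ (by omega : I.m ≤ B) (by decide) (by decide)
    (by decide) (fun s' hf => (hR₁.frame hf).eval_vertices) ?_).imp ?_
  · intro w hw s₂ hs₂ hf₂ hc₂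
    have hR₂ := hR₁.frame hf₂
    refine .skip hs₂ ⟨trivial, ?_⟩
    simp only [Test.Holds, IdxExp.eval, hR₂.idx_zero, input_vertices, hf₂.idx 14 (by decide),
      hc₁, hf₂.idx 10 (by decide), hf₁.idx 10 (by decide), hv, hc₂]
    refine hR₂.table.near ?_ hvm hw
    -- Layer `t + 1 ≤ m` is read, which is why the table needs `m + 1` layers.
    calc ((t + 1) * I.m + v) * I.m + w < ((t + 1) * I.m + v) * I.m + I.m := by omega
      _ = ((t + 1) * I.m + (v + 1)) * I.m := by ring
      _ ≤ ((t + 1) * I.m + I.m) * I.m := Nat.mul_le_mul_right _ (by omega)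
      _ = (t + 1 + 1) * I.m * I.m := by ring
      _ ≤ (I.m + 1) * I.m * I.m :=
        Nat.mul_le_mul_right _ (Nat.mul_le_mul_right _ (by omega))
  · intro s₂ hs₂ hf₂ hcount
    refine ⟨trivial, ?_⟩
    simp only [Test.Holds, IdxExp.eval, hcount, hf₂.idx 13 (by decide), hf₁.idx 13 (by decide),
      hr, ballCard]

theorem runs_computeValue {i v : ℕ} (hB : I.SizeBound sz B) (hs : s.Bounded sz B)
    (hR : Ready I s) (hi : s.idx 9 0 = i) (hin : i < I.n) (hv : s.idx 10 0 = v) (hvm : v < I.m) :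
    Runs sz B computeValue s fun s' => s'.num 2 0 = I.value i v := by
  have hm := hB.vertices
  have hn := I.agents_le
  refine .seq (.setNum hs hB.zero ?_)
  simp only [IdxExp.eval, NumExp.eval]
  have hf₀ : s.Frame computeValue (s.setNum 2 0 0) :=
    ⟨fun a ha => rfl, fun a ha => s.setNum_num_of_ne (fun h => ha (by rw [h]; decide)) _ _⟩
  have hR₀ := hR.frame hf₀
  refine .loop (fun k s' => s'.num 2 0 =
    ∑ j ∈ Finset.range k, I.util i j * I.fac (I.slotDist v (I.rank i j))) (hs.setNum _ _ hB.zero)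
    (by omega : I.n ≤ B) (by decide) (fun s' hf => (hR₀.frame hf).eval_agents)
    (by simp [Memory.setNum_num])
    (fun k s' v h => h) ?_
  intro j hj s₁ hs₁ hf₁ hc₁ hS
  have hR₁ := hR₀.frame hf₁
  have hi₁ : s₁.idx 9 0 = i := by rw [hf₁.idx 9 (by decide), hf₀.idx 9 (by decide), hi]
  have hv₁ : s₁.idx 10 0 = v := by rw [hf₁.idx 10 (by decide), hf₀.idx 10 (by decide), hv]
  refine .seq ((runs_computeRank hB hs₁ hR₁ hi₁ hc₁).imp fun s₂ hs₂ hf₂ hr => ?_)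
  have hR₂ := hR₁.frame hf₂
  refine .seq ((runs_computeSlot hB hs₂ hR₂ (by rw [hf₂.idx 10 (by decide), hv₁]) hr hvm).imp
    fun s₃ hs₃ hf₃ hd => ?_)
  have hR₃ := hR₂.frame hf₃
  have hi₃ : s₃.idx 9 0 = i := by rw [hf₃.idx 9 (by decide), hf₂.idx 9 (by decide), hi₁]
  have hj₃ : s₃.idx 11 0 = j := by rw [hf₃.idx 11 (by decide), hf₂.idx 11 (by decide), hc₁]
  have hS₃ : s₃.num 2 0 = s₁.num 2 0 := by rw [hf₃.num 2 (by decide), hf₂.num 2 (by decide)]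
  have hmul : (NumExp.mul (util (.var 9) (.var 11)) (.read 1 (.var 17))).eval s₃ =
      I.util i j * I.fac (I.slotDist v (I.rank i j)) := by
    rw [NumExp.eval, hR₃.eval_util]
    simp only [NumExp.eval, IdxExp.eval, hi₃, hj₃, hd, hR₃.num_one, fac]
  have hadd : (NumExp.read 2 (.const 0)).eval s₃ +
      (NumExp.mul (util (.var 9) (.var 11)) (.read 1 (.var 17))).eval s₃ =
      ∑ j ∈ Finset.range (j + 1), I.util i j * I.fac (I.slotDist v (I.rank i j)) := by
    rw [hmul, Finset.sum_range_succ, ← hS, ← hS₃]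
    rfl
  refine .setNum hs₃ ⟨trivial, ⟨trivial, trivial, ?_⟩, ?_⟩ ?_
  · rw [NumExp.eval] at hmul
    rw [hmul]
    exact hB.mul i hin j hj _
  · rw [hadd]
    exact hB.sum i hin _ (by omega) _
  · rw [Memory.setNum_num, if_pos ⟨rfl, rfl⟩, NumExp.eval, hadd]

theorem runs_main (hB : I.SizeBound sz B) :
    Runs sz B main I.input fun s => s.Accepts ↔ ∀ i < I.n, ∃ v < I.m, 0 ≤ I.value i v := by
  have hm := hB.vertices
  have hn := I.agents_le
  refine .seq ((runs_fillTable hB).imp fun s₀ hs₀ hf₀ hT => ?_)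
  have hI : I.HasInput I.input := ⟨rfl, rfl, rfl, rfl⟩
  have hR : Ready I s₀ := ⟨hI.frame hf₀, hT⟩
  refine .seq ((Runs.count (fun i => ¬ ∃ v < I.m, 0 ≤ I.value i v) hs₀ (by omega : I.n ≤ B)
    (by decide) (by decide) (by decide) (fun s' hf => (hR.frame hf).eval_agents) ?_).imp ?_)
  · intro i hi s₁ hs₁ hf₁ hc₁
    have hR₁ := hR.frame hf₁
    refine (Runs.count (fun v => 0 ≤ I.value i v) hs₁ (by omega : I.m ≤ B)
      (by decide) (by decide) (by decide) (fun s' hf => (hR₁.frame hf).eval_vertices) ?_).imp ?_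
    · intro v hv s₂ hs₂ hf₂ hc₂
      refine (runs_computeValue hB hs₂ (hR₁.frame hf₂)
        (by rw [hf₂.idx 9 (by decide), hc₁]) hi hc₂ hv).imp fun s₃ _ _ h => ?_
      refine ⟨⟨hB.zero, trivial⟩, ?_⟩
      simp [Test.Holds, NumExp.eval, IdxExp.eval, h]
    · intro s₂ _ _ h
      refine ⟨trivial, ?_⟩
      simp only [Test.Holds, IdxExp.eval, h]
      rw [not_le, Nat.lt_one_iff, Nat.count_iff_forall_not]
      push Not
      rfl
  · intro s₁ hs₁ _ h
    refine .setIdx hs₁ (by simp only [IdxExp.eval]; omega) ?_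
    simp only [IdxExp.eval, h, Memory.Accepts, Memory.setIdx_idx_self]
    rw [← not_iff_not, show ∀ a, ¬ 1 - a = 1 ↔ ¬ a = 0 by omega, not_iff_not,
      Nat.count_iff_forall_not]
    simp only [not_not]

end IRProg

end Correctness

/-! ## Optimal assignments -/

section Optimal

open Classical

theorem Nat.count_congr_of_lt {p q : ℕ → Prop} [DecidablePred p] [DecidablePred q] {n : ℕ}
    (h : ∀ k < n, p k ↔ q k) : Nat.count p n = Nat.count q n :=
  le_antisymm (Nat.count_mono_left fun k hk => (h k hk).1)
    (Nat.count_mono_left fun k hk => (h k hk).2)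

theorem Fin.card_filter_eq_count {m : ℕ} (p : Fin m → Prop) (q : ℕ → Prop) [DecidablePred p]
    [DecidablePred q] (h : ∀ x : Fin m, p x ↔ q x) :
    (Finset.univ.filter p).card = Nat.count q m := by
  rw [Nat.count_eq_card_filter_range, ← Finset.card_map Fin.valEmbedding]
  congr 1
  ext k
  simp only [Finset.mem_map, Finset.mem_filter, Finset.mem_univ, true_and, Fin.valEmbedding_apply,
    Finset.mem_range]
  exact ⟨fun ⟨x, hx, hk⟩ => hk ▸ ⟨x.2, (h x).1 hx⟩, fun ⟨hk, hq⟩ => ⟨⟨k, hk⟩, (h _).2 hq, rfl⟩⟩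

theorem Nat.count_lt {d m : ℕ} (h : d ≤ m) : Nat.count (fun t => t < d) m = d := by
  obtain ⟨c, rfl⟩ := Nat.exists_eq_add_of_le h
  rw [Nat.count_add, (Nat.count_iff_forall (p := fun t => t < d)).2 fun _ h => h,
    (Nat.count_iff_forall_not (p := fun t => d + t < d)).2 fun _ _ => by omega, add_zero]

/-! ### Ranks in finite linear orders -/

/-- The number of elements with a smaller key. -/
noncomputable def keyRank {α L : Type*} [Fintype α] [LinearOrder L] (key : α → L) (a : α) : ℕ :=
  (Finset.univ.filter fun x => key x < key a).card

section KeyRank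

variable {α L L' : Type*} [Fintype α] [LinearOrder L] [LinearOrder L'] {key : α → L}
  {key' : α → L'}

theorem keyRank_lt_keyRank {a b : α} (h : key a < key b) : keyRank key a < keyRank key b := by
  refine Finset.card_lt_card ((Finset.ssubset_iff_of_subset fun x hx => ?_).2 ⟨a, ?_⟩)
  · simp only [Finset.mem_filter, Finset.mem_univ, true_and] at hx ⊢
    exact hx.trans h
  · simpa using h

theorem lt_of_keyRank_lt {a b : α} (h : keyRank key a < keyRank key b) : key a < key b := by
  by_contra hn
  rcases (not_lt.1 hn).lt_or_eq with h' | h'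
  · exact (keyRank_lt_keyRank h').asymm h
  · simp [keyRank, h'] at h

theorem keyRank_injective (hk : Function.Injective key) :
    Function.Injective (keyRank key) := by
  intro a b h
  refine hk (le_antisymm ?_ ?_) <;> refine not_lt.1 fun hl => ?_ <;>
    exact absurd h (by have := keyRank_lt_keyRank hl; omega)

theorem keyRank_lt (key : α → L) (a : α) : keyRank key a < Fintype.card α := by
  refine Finset.card_lt_univ_of_notMem (x := a) ?_
  simp

/-- Two linear orders on a finite type are matched by a permutation. -/
theorem exists_perm_keyRank_eq (hk : Function.Injective key) (hk' : Function.Injective key') :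
    ∃ e : Equiv.Perm α, ∀ a, keyRank key' (e a) = keyRank key a := by
  have hbij : ∀ r : α → Fin (Fintype.card α), Function.Injective r → Function.Bijective r :=
    fun r hr => (Fintype.bijective_iff_injective_and_card r).2 ⟨hr, by simp⟩
  let e₁ := Equiv.ofBijective (fun a => (⟨keyRank key a, keyRank_lt key a⟩ : Fin _))
    (hbij _ fun a b h => keyRank_injective hk (Fin.mk.inj_iff.1 h))
  let e₂ := Equiv.ofBijective (fun a => (⟨keyRank key' a, keyRank_lt key' a⟩ : Fin _))
    (hbij _ fun a b h => keyRank_injective hk' (Fin.mk.inj_iff.1 h))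
  exact ⟨e₁.trans e₂.symm, fun a => congrArg Fin.val (e₂.apply_symm_apply (e₁ a))⟩

end KeyRank

/-! ### The optimal utility of an agent at a given vertex -/

namespace TDG

variable {K : Type} [Field K] [LinearOrder K]

/-- The distance of two vertices, with value `m` instead of `∞`. -/
noncomputable def vdist (I : TDG K) (v w : Fin I.m) : ℕ :=
  if I.G.edist v w = ⊤ then I.m else (I.G.edist v w).toNat

/-- A shortest walk is a path and has fewer than `m` edges. This makes `m` available as a code for
`∞`. -/
theorem edist_toNat_lt (I : TDG K) {v w : Fin I.m} (h : I.G.edist v w ≠ ⊤) :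
    (I.G.edist v w).toNat < I.m := by
  obtain ⟨p, hp, hl⟩ := (SimpleGraph.edist_ne_top_iff_reachable.1 h).exists_path_of_dist
  have := hp.length_lt
  rw [hl, Fintype.card_fin] at this
  exact this

theorem vdist_le (I : TDG K) (v w : Fin I.m) : I.vdist v w ≤ I.m := by
  unfold vdist
  split_ifs with h
  · exact le_rfl
  · exact (I.edist_toNat_lt h).le

@[simp] theorem vdist_self (I : TDG K) (v : Fin I.m) : I.vdist v v = 0 := by
  simp [vdist]

theorem eq_of_vdist_eq_zero (I : TDG K) {v w : Fin I.m} (h : I.vdist v w = 0) : v = w := by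
  unfold vdist at h
  split_ifs at h with ht
  · exact absurd v.2 (by omega)
  · exact SimpleGraph.edist_eq_zero_iff.1 ((ENat.toNat_eq_zero.1 h).resolve_right ht)

theorem vdist_le_iff (I : TDG K) {t : ℕ} (ht : t < I.m) (v w : Fin I.m) :
    I.vdist v w ≤ t ↔ I.Near (t + 1) v w := by
  have hN : I.Near (t + 1) v w ↔ I.G.edist v w < (t + 1 : ℕ) :=
    ⟨fun ⟨_, _, h⟩ => h, fun h => ⟨v.2, w.2, h⟩⟩
  rw [hN]
  unfold vdist
  split_ifs with h
  · rw [h]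
    simp [ht]
  · conv_rhs => rw [← ENat.natCast_toNat h]
    rw [Nat.cast_lt, Nat.lt_succ_iff]

/-- The code `m` for `∞` gives the right factor because the array of factors is `0` at position `m`.
Equal vertices are excluded: the array is also `0` at position `0`, whereas `f 0 > 0`. -/
theorem fac_vdist (I : TDG K) {v w : Fin I.m} (h : v ≠ w) :
    I.fac (I.vdist v w) = I.factor (I.G.edist v w) := by
  have h0 : 1 ≤ I.vdist v w := Nat.one_le_iff_ne_zero.2 fun h' => h (I.eq_of_vdist_eq_zero h')
  unfold vdist at h0 ⊢
  unfold factor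
  split_ifs at h0 ⊢ with ht
  · simp [fac, input]
  · simp [fac, input, I.edist_toNat_lt ht, h0]

theorem fac_antitone (I : TDG K) {a b : ℕ} (ha : 1 ≤ a) (h : a ≤ b) : I.fac b ≤ I.fac a := by
  by_cases hb : b < I.m
  · simpa [fac, input, hb, ha, ha.trans h, h.trans_lt hb] using I.f_anti.antitone h
  · by_cases hm : a < I.m
    · simpa [fac, input, hb, ha, hm] using (I.f_pos a).le
    · simp [fac, input, hb, hm]

/-- The utilities of the agent `i`, with value `0` for the empty vertices. -/
noncomputable def paddedUtil (I : TDG K) (i : Fin I.n) (k : Fin I.m) : K :=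
  if h : k.1 < I.n then I.u i ⟨k, h⟩ else 0

/-- The order in which `i` places the agents and the empty vertices. -/
noncomputable def agentKey (I : TDG K) (i : Fin I.n) (k : Fin I.m) : ℕ ×ₗ Kᵒᵈ ×ₗ Fin I.m :=
  toLex (if k = Fin.castLE I.agents_le i then 0 else 1,
    toLex (OrderDual.toDual (I.paddedUtil i k), k))

/-- The index breaks ties, so that distinct vertices have distinct ranks. -/
noncomputable def vertexKey (I : TDG K) (v w : Fin I.m) : ℕ ×ₗ Fin I.m :=
  toLex (I.vdist v w, w)

theorem agentKey_injective (I : TDG K) (i : Fin I.n) : Function.Injective (I.agentKey i) :=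
  fun _ _ h => congrArg (fun x => (ofLex (ofLex x).2).2) h

theorem vertexKey_injective (I : TDG K) (v : Fin I.m) : Function.Injective (I.vertexKey v) :=
  fun _ _ h => congrArg (fun x => (ofLex x).2) h

theorem agentKey_lt_iff (I : TDG K) (i : Fin I.n) (x k : Fin I.m)
    (hk : k ≠ Fin.castLE I.agents_le i) :
    I.agentKey i x < I.agentKey i k ↔ x = Fin.castLE I.agents_le i ∨
      (I.paddedUtil i k < I.paddedUtil i x ∨ I.paddedUtil i k = I.paddedUtil i x ∧ x < k) := by
  simp only [agentKey, Prod.Lex.toLex_lt_toLex, if_neg hk, OrderDual.toDual_lt_toDual,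
    OrderDual.toDual_inj]
  by_cases hx : x = Fin.castLE I.agents_le i
  · simp [hx]
  · simp [hx, eq_comm]

/-- The positions before `j` are counted separately among the agents and among the empty vertices.
The latter have utility `0` and larger indices than all agents, so they lose ties; either all of
them precede `j` or none does, according to the sign of the utility of `j`. The case `j = i` is
excluded because `Before` always counts `i` itself. -/
theorem keyRank_agentKey (I : TDG K) {i j : Fin I.n} (h : j ≠ i) :
    keyRank (I.agentKey i) (Fin.castLE I.agents_le j) = I.rank i j := by
  have hji : Fin.castLE I.agents_le j ≠ Fin.castLE I.agents_le i := fun he =>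
    h (Fin.castLE_injective _ he)
  have hpad : ∀ k : Fin I.n, I.paddedUtil i (Fin.castLE I.agents_le k) = I.util i k := fun k => by
    simp [paddedUtil, util_of_lt]
  unfold keyRank rank
  rw [Fin.card_filter_eq_count _ (fun x => ∃ hx : x < I.m,
    I.agentKey i ⟨x, hx⟩ < I.agentKey i (Fin.castLE I.agents_le j)) fun x => by simp]
  have hcount : ∀ (p : ℕ → Prop) [DecidablePred p], Nat.count p I.m =
      Nat.count p I.n + Nat.count (fun k => p (I.n + k)) (I.m - I.n) := fun p _ => by
    rw [← Nat.count_add, Nat.add_sub_cancel' I.agents_le]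
  rw [hcount]
  congr 1
  · refine Nat.count_congr_of_lt fun k hk => ?_
    have hkm := hk.trans_le I.agents_le
    have hx := hpad ⟨k, hk⟩
    simp only [hkm, exists_true_left, agentKey_lt_iff I i _ _ hji, hpad, Before]
    simp only [Fin.castLE_mk] at hx
    rw [hx]
    simp only [Fin.ext_iff, Fin.val_castLE, Fin.lt_def]
    refine or_congr_right ?_
    rw [le_iff_lt_or_eq]
    have := fun h : I.util i j = I.util i k => h.not_lt
    tauto
  · have key : ∀ k, k < I.m - I.n → ((∃ hx : I.n + k < I.m,
        I.agentKey i ⟨I.n + k, hx⟩ < I.agentKey i (Fin.castLE I.agents_le j)) ↔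
        ¬ 0 ≤ I.util i j) := by
      intro k hk
      have hkm : I.n + k < I.m := by omega
      have h0 : I.paddedUtil i ⟨I.n + k, hkm⟩ = 0 := by simp [paddedUtil]
      have h1 : ¬ I.n + k < j := by omega
      have h2 : ¬ I.n + k = i := by omega
      simp [hkm, agentKey_lt_iff I i _ _ hji, hpad, h0, Fin.ext_iff, Fin.lt_def, h1, h2]
    rw [Nat.count_congr_of_lt key]
    split_ifs with h0 <;> simp [h0]

/-- Let `d` be the distance of `w` from `v`. For `t < d` every vertex of the ball of radius `t`
precedes `w`, so the ball has at most as many elements as the rank of `w`. For `t ≥ d` the ball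
contains `w` and everything before it, hence more elements. So exactly the radii below `d` are
counted. -/
theorem slotDist_keyRank (I : TDG K) (v w : Fin I.m) :
    I.slotDist v (keyRank (I.vertexKey v) w) = I.vdist v w := by
  rw [slotDist, ← Nat.count_lt (I.vdist_le v w)]
  refine Nat.count_congr_of_lt fun t ht => ?_
  rw [ballCard, ← Fin.card_filter_eq_count (fun x => I.vdist v x ≤ t) _ fun x =>
    I.vdist_le_iff ht v x]
  unfold keyRank vertexKey
  simp only [Prod.Lex.toLex_lt_toLex]
  refine ⟨fun h => ?_, fun h => Finset.card_le_card fun x hx => ?_⟩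
  · by_contra hn
    refine (Finset.card_lt_card ((Finset.ssubset_iff_of_subset fun x hx => ?_).2
      ⟨w, ?_⟩)).not_ge h
    · simp only [Finset.mem_filter, Finset.mem_univ, true_and] at hx ⊢
      omega
    · simpa using hn
  · simp only [Finset.mem_filter, Finset.mem_univ, true_and] at hx ⊢
    exact .inl (hx.trans_lt h)

/-- The utility of the agent `i` at the vertex `v`, if the other agents are placed by `σ`. -/
noncomputable def permUtility (I : TDG K) (i : Fin I.n) (v : Fin I.m)
    (σ : Equiv.Perm (Fin I.m)) : K :=
  ∑ k ∈ Finset.univ.erase (Fin.castLE I.agents_le i), I.paddedUtil i k * I.fac (I.vdist v (σ k))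

theorem sum_castLE (I : TDG K) (i : Fin I.n) (g : Fin I.m → K) :
    ∑ k ∈ Finset.univ.erase (Fin.castLE I.agents_le i), I.paddedUtil i k * g k =
      ∑ j ∈ Finset.univ.erase i, I.u i j * g (Fin.castLE I.agents_le j) := by
  have h : ∀ j : Fin I.n, I.paddedUtil i (Fin.castLE I.agents_le j) = I.u i j := fun j => by
    simp [paddedUtil]
  simp only [← h]
  refine .trans ?_ (Finset.sum_map (Finset.univ.erase i) (Fin.castLEEmb I.agents_le)
    (fun k => I.paddedUtil i k * g k))
  refine (Finset.sum_subset (fun k hk => ?_) fun k hk hk' => ?_).symm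
  · obtain ⟨j, hj, rfl⟩ := Finset.mem_map.1 hk
    simpa [Fin.ext_iff] using hj
  · have : ¬ k.1 < I.n := fun hn => hk' (Finset.mem_map.2 ⟨⟨k, hn⟩, by
      simpa [Fin.ext_iff] using hk, rfl⟩)
    simp [paddedUtil, this]

theorem utility_eq_permUtility (I : TDG K) (a : Fin I.n ↪ Fin I.m) (i : Fin I.n)
    (σ : Equiv.Perm (Fin I.m)) (h : ∀ j, σ (Fin.castLE I.agents_le j) = a j) :
    I.utility a i = I.permUtility i (a i) σ := by
  rw [permUtility, I.sum_castLE i fun k => I.fac (I.vdist (a i) (σ k)), utility]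
  refine Finset.sum_congr rfl fun j hj => ?_
  rw [h, fac_vdist]
  exact fun he => (Finset.mem_erase.1 hj).1 (a.injective he).symm

theorem value_eq_permUtility (I : TDG K) (i : Fin I.n) (v : Fin I.m) (e : Equiv.Perm (Fin I.m))
    (he : ∀ k, keyRank (I.vertexKey v) (e k) = keyRank (I.agentKey i) k) :
    I.value i v = I.permUtility i v e := by
  -- The sum in `value` includes `j = i`, for which `rank` has no meaning; the term vanishes since
  -- `u i i = 0`.
  rw [permUtility, I.sum_castLE i fun k => I.fac (I.vdist v (e k)), value, Finset.sum_range,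
    ← Finset.add_sum_erase _ _ (Finset.mem_univ i), util_of_lt I i.2 i.2, I.u_self, zero_mul,
    zero_add]
  refine Finset.sum_congr rfl fun j hj => ?_
  rw [util_of_lt I i.2 j.2, ← keyRank_agentKey I (Finset.mem_erase.1 hj).1, ← he,
    slotDist_keyRank]

/-- Both sides have rank `0`: agent `i` comes first in its own order, and `v` is the only vertex at
distance `0` from `v`. -/
theorem apply_eq_of_keyRank_eq (I : TDG K) (i : Fin I.n) (v : Fin I.m) (e : Equiv.Perm (Fin I.m))
    (he : ∀ k, keyRank (I.vertexKey v) (e k) = keyRank (I.agentKey i) k) :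
    e (Fin.castLE I.agents_le i) = v := by
  refine keyRank_injective (I.vertexKey_injective v) ((he _).trans ?_)
  trans 0
  · rw [keyRank, Finset.card_eq_zero, Finset.filter_eq_empty_iff]
    intro x _ h
    simp only [agentKey, Prod.Lex.toLex_lt_toLex, if_pos] at h
    by_cases hx : x = Fin.castLE I.agents_le i
    · simp [hx] at h
    · simp [hx] at h
  · symm
    rw [keyRank, Finset.card_eq_zero, Finset.filter_eq_empty_iff]
    intro x _ h
    simp only [vertexKey, Prod.Lex.toLex_lt_toLex, vdist_self, not_lt_zero, false_or] at h
    exact h.2.ne' (I.eq_of_vdist_eq_zero h.1)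

theorem exists_utility_eq_value (I : TDG K) (i : Fin I.n) (v : Fin I.m) :
    ∃ a : Fin I.n ↪ Fin I.m, I.utility a i = I.value i v := by
  obtain ⟨e, he⟩ := exists_perm_keyRank_eq (I.agentKey_injective i) (I.vertexKey_injective v)
  refine ⟨(Fin.castLEEmb I.agents_le).trans e.toEmbedding, ?_⟩
  rw [I.value_eq_permUtility i v e he, I.utility_eq_permUtility _ i e fun j => rfl]
  congr 1
  exact I.apply_eq_of_keyRank_eq i v e he

theorem factor_nonneg (I : TDG K) (d : ℕ∞) : 0 ≤ I.factor d := by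
  unfold factor
  split_ifs
  · exact le_rfl
  · exact (I.f_pos _).le

variable [IsStrictOrderedRing K]

/-- Rearrangement inequality: under `e`, padded utilities and distance factors are ordered alike.
Agent `i` has to be left out, because `fac` is monotone only from distance `1` on. -/
theorem permUtility_le (I : TDG K) (i : Fin I.n) (v : Fin I.m) (e σ : Equiv.Perm (Fin I.m))
    (he : ∀ k, keyRank (I.vertexKey v) (e k) = keyRank (I.agentKey i) k)
    (hσ : σ (Fin.castLE I.agents_le i) = v) : I.permUtility i v σ ≤ I.permUtility i v e := by
  have hei := I.apply_eq_of_keyRank_eq i v e he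
  have hmono : MonovaryOn (I.paddedUtil i) (fun k => I.fac (I.vdist v (e k)))
      (Finset.univ.erase (Fin.castLE I.agents_le i) : Finset (Fin I.m)) := by
    intro a ha b hb hab
    simp only [Finset.coe_erase, Set.mem_sdiff, Set.mem_singleton_iff] at ha hb
    have hlt : I.vdist v (e b) < I.vdist v (e a) := by
      by_contra hn
      refine (I.fac_antitone ?_ (not_lt.1 hn)).not_gt hab
      refine Nat.one_le_iff_ne_zero.2 fun h0 => ha.2 (e.injective ?_)
      rw [hei, ← I.eq_of_vdist_eq_zero h0]
    have hkey : I.vertexKey v (e b) < I.vertexKey v (e a) := by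
      simp [vertexKey, Prod.Lex.toLex_lt_toLex, hlt]
    have := keyRank_lt_keyRank hkey
    rw [he, he] at this
    rcases (I.agentKey_lt_iff i b a ha.2).1 (lt_of_keyRank_lt this) with h | h | h
    · exact absurd h hb.2
    · exact h.le
    · exact h.1.le
  -- The rearranging permutation, `σ` followed by the inverse of `e`, fixes `i`, since both send `i`
  -- to `v`; so it moves only the remaining indices.
  have := hmono.sum_mul_comp_perm_le_sum_mul (σ := σ.trans e.symm) fun x hx => by
    simp only [Finset.coe_erase, Finset.coe_univ, Set.mem_sdiff, Set.mem_univ, true_and,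
      Set.mem_singleton_iff]
    rintro rfl
    refine hx ?_
    rw [Equiv.trans_apply, hσ, ← hei, Equiv.symm_apply_apply]
  simpa [permUtility] using this

/-- The assignment extends to a permutation of all `m` vertices, with the dummies on the empty ones,
and the rearrangement bound applies. -/
theorem utility_le_value (I : TDG K) (a : Fin I.n ↪ Fin I.m) (i : Fin I.n) :
    I.utility a i ≤ I.value i (a i) := by
  obtain ⟨e, he⟩ := exists_perm_keyRank_eq (I.agentKey_injective i) (I.vertexKey_injective (a i))
  obtain ⟨σ, hσ⟩ := Equiv.Perm.exists_extending_pair (Fin.castLE I.agents_le) a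
    (Fin.castLE_injective _) a.injective
  rw [I.value_eq_permUtility i (a i) e he, I.utility_eq_permUtility a i σ hσ]
  exact I.permUtility_le i (a i) e σ he (hσ i)

/-- Backwards, an assignment that is optimal for the agent with enemies at a suitable vertex
satisfies everyone, as the others are never dissatisfied. Testing all agents spares the program the
search for the exceptional one. -/
theorem hasIRAssignment_iff (I : TDG K) (h : I.AtMostOneHasEnemies) :
    I.HasIRAssignment ↔ ∀ i < I.n, ∃ v < I.m, 0 ≤ I.value i v := by
  constructor
  · rintro ⟨a, ha⟩ i hi
    exact ⟨a ⟨i, hi⟩, (a ⟨i, hi⟩).2, (ha ⟨i, hi⟩).trans (I.utility_le_value a ⟨i, hi⟩)⟩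
  · intro hv
    have hnonneg : ∀ (a : Fin I.n ↪ Fin I.m) (i : Fin I.n), (¬ ∃ j, I.Enemy i j) →
        0 ≤ I.utility a i := fun a i hi =>
      Finset.sum_nonneg fun j _ => mul_nonneg (not_lt.1 fun hj => hi ⟨j, hj⟩) (I.factor_nonneg _)
    by_cases hp : ∃ p : Fin I.n, ∃ j, I.Enemy p j
    · obtain ⟨p, hp⟩ := hp
      obtain ⟨v, hvm, hpv⟩ := hv p p.2
      obtain ⟨a, ha⟩ := I.exists_utility_eq_value p ⟨v, hvm⟩
      refine ⟨a, fun i => ?_⟩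
      by_cases hi : ∃ j, I.Enemy i j
      · rw [h hi hp, ha]
        exact hpv
      · exact hnonneg a i hi
    · exact ⟨Fin.castLEEmb I.agents_le, fun i => hnonneg _ i fun hi => hp ⟨i, hi⟩⟩

end TDG

end Optimal

/-! ## Bit lengths of sums of products -/

section BitSize

/-- `x` is a fraction with denominator `Q` and a numerator of absolute value at most `N`. -/
def IsFrac (Q N : ℕ) (x : ℚ) : Prop :=
  ∃ z : ℤ, x * Q = z ∧ z.natAbs ≤ N

namespace IsFrac

variable {Q Q' N N' : ℕ} {x y : ℚ}

theorem zero (Q N : ℕ) : IsFrac Q N 0 := ⟨0, by simp⟩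

theorem add (hx : IsFrac Q N x) (hy : IsFrac Q N' y) : IsFrac Q (N + N') (x + y) := by
  obtain ⟨z, hz, hzN⟩ := hx
  obtain ⟨w, hw, hwN⟩ := hy
  exact ⟨z + w, by push_cast; rw [add_mul, hz, hw], by omega⟩

theorem mul (hx : IsFrac Q N x) (hy : IsFrac Q' N' y) : IsFrac (Q * Q') (N * N') (x * y) := by
  obtain ⟨z, hz, hzN⟩ := hx
  obtain ⟨w, hw, hwN⟩ := hy
  exact ⟨z * w, by push_cast; rw [← hz, ← hw]; ring, by
    rw [Int.natAbs_mul]; exact Nat.mul_le_mul hzN hwN⟩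

theorem mono (hx : IsFrac Q N x) (h : N ≤ N') : IsFrac Q N' x :=
  let ⟨z, hz, hzN⟩ := hx
  ⟨z, hz, hzN.trans h⟩

theorem sum_range {g : ℕ → ℚ} {k : ℕ} (h : ∀ j < k, IsFrac Q N (g j)) :
    IsFrac Q (k * N) (∑ j ∈ Finset.range k, g j) := by
  induction k with
  | zero => exact zero _ _
  | succ k ih =>
    rw [Finset.sum_range_succ, add_mul, one_mul]
    exact (ih fun j hj => h j (by omega)).add (h k (by omega))

theorem of_den_dvd (h : x.den ∣ Q) : IsFrac Q (x.num.natAbs * Q) x := by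
  obtain ⟨c, rfl⟩ := h
  refine ⟨x.num * c, ?_, ?_⟩
  · push_cast
    rw [← mul_assoc, Rat.mul_den_eq_num]
  · rw [Int.natAbs_mul, Int.natAbs_natCast]
    exact Nat.mul_le_mul_left _ (Nat.le_mul_of_pos_left _ x.den_pos)

/-- Reduction to lowest terms does not increase the denominator or the absolute value of the
numerator. The `3` consists of the sign bit and one extra bit for each of the two, as `r ≤ 2 ^ e`
has up to `e + 1` bits. -/
theorem bitSize_le {a b : ℕ} (hx : IsFrac Q N x) (h0 : 0 < Q) (hQ : Q ≤ 2 ^ a) (hN : N ≤ 2 ^ b) :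
    bitSize x ≤ a + b + 3 := by
  obtain ⟨z, hz, hzN⟩ := hx
  have hxz : x = Rat.divInt z Q := by
    rw [Rat.divInt_eq_div, Int.cast_natCast, eq_div_iff (by positivity), hz]
  have hden : x.den ∣ Q := by
    have := Rat.den_dvd z Q
    rw [← hxz] at this
    exact_mod_cast this
  have hnum : x.num.natAbs ≤ z.natAbs := by
    obtain ⟨c, rfl⟩ := hden
    have hc : 1 ≤ c := Nat.pos_of_mul_pos_left h0
    have : z = x.num * c := by
      have h : (z : ℚ) = x.num * c := by
        rw [← hz, ← Rat.mul_den_eq_num]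
        push_cast
        ring
      exact_mod_cast h
    rw [this, Int.natAbs_mul, Int.natAbs_natCast]
    exact Nat.le_mul_of_pos_right _ hc
  have hsize : ∀ r e : ℕ, r ≤ 2 ^ e → r.size ≤ e + 1 := fun r e h =>
    Nat.size_le.2 (h.trans_lt (Nat.pow_lt_pow_right one_lt_two (Nat.lt_succ_self e)))
  have h1 := hsize _ _ (hnum.trans (hzN.trans hN))
  have h2 := hsize _ _ ((Nat.le_of_dvd h0 hden).trans hQ)
  unfold bitSize
  omega

end IsFrac

theorem prod_den_le {ι : Type*} (s : Finset ι) (g : ι → ℚ) :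
    ∏ i ∈ s, (g i).den ≤ 2 ^ ∑ i ∈ s, bitSize (g i) := by
  rw [← Finset.prod_pow_eq_pow_sum]
  refine Finset.prod_le_prod' fun i _ => (Nat.lt_size_self _).le.trans ?_
  exact Nat.pow_le_pow_right two_pos (Nat.le_add_left _ _)

theorem natAbs_num_le (x : ℚ) : x.num.natAbs ≤ 2 ^ bitSize x :=
  (Nat.lt_size_self _).le.trans (Nat.pow_le_pow_right two_pos (by unfold bitSize; omega))

end BitSize

/-! ### Linear bounds for the numbers in a run, and the conclusion -/

namespace TDG

section Sizes

variable {K : Type} [Field K] [LinearOrder K]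

theorem sum_sz_util_le (sz : K → ℕ) (I : TDG K) (i : Fin I.n) :
    ∑ j, sz (I.u i j) ≤ I.inputSize sz := by
  have := Finset.single_le_sum (f := fun i => ∑ j, sz (I.u i j)) (fun _ _ => Nat.zero_le _)
    (Finset.mem_univ i)
  unfold inputSize
  omega

theorem sz_util_le (sz : K → ℕ) (I : TDG K) (i j : Fin I.n) :
    sz (I.u i j) ≤ I.inputSize sz :=
  (Finset.single_le_sum (f := fun j => sz (I.u i j)) (fun _ _ => Nat.zero_le _)
    (Finset.mem_univ j)).trans (I.sum_sz_util_le sz i)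

theorem sum_sz_f_le (sz : K → ℕ) (I : TDG K) :
    ∑ d ∈ Finset.Ico 1 I.m, sz (I.f d) ≤ I.inputSize sz :=
  Nat.le_add_left _ _

theorem sz_f_le (sz : K → ℕ) (I : TDG K) {d : ℕ} (h : d ∈ Finset.Ico 1 I.m) :
    sz (I.f d) ≤ I.inputSize sz :=
  (Finset.single_le_sum (f := fun d => sz (I.f d)) (fun _ _ => Nat.zero_le _) h).trans
    (I.sum_sz_f_le sz)

end Sizes

-- The bound has the form required in the rational case, so that both models share one argument;
-- here it is far from tight.
theorem sizeBound_unitSize (I : TDG ℝ) : I.SizeBound unitSize (7 * I.inputSize unitSize + 3) where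
  vertices := by unfold inputSize; omega
  zero := by unfold unitSize; omega
  num _ _ := by unfold unitSize; omega
  mul _ _ _ _ _ := by unfold unitSize; omega
  sum _ _ _ _ _ := by unfold unitSize; omega

/-- The denominator depends neither on `j` nor on `d`, so sums of such products do not enlarge it.
Each of the two factors has a numerator of at most `2 ^ S`, expanded by a common denominator of at
most `2 ^ S`, where `S` is the input size; this gives the exponent `4 * S`. -/
theorem isFrac_util_mul_fac (I : TDG ℚ) (i : Fin I.n) {j : ℕ} (hj : j < I.n) (d : ℕ) :
    IsFrac ((∏ k, (I.u i k).den) * ∏ e ∈ Finset.Ico 1 I.m, (I.f e).den)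
      (2 ^ (4 * I.inputSize bitSize)) (I.util i j * I.fac d) := by
  set S := I.inputSize bitSize with hS
  have h2 : ∀ {a b : ℕ}, a ≤ 2 ^ S → b ≤ 2 ^ S → a * b ≤ 2 ^ (2 * S) := fun ha hb => by
    rw [two_mul, pow_add]
    exact Nat.mul_le_mul ha hb
  have hpow : ∀ {e}, e ≤ S → 2 ^ e ≤ 2 ^ S := fun h => Nat.pow_le_pow_right two_pos h
  have hu : IsFrac (∏ k, (I.u i k).den) (2 ^ (2 * S)) (I.util i j) := by
    rw [util_of_lt I i.2 hj]
    refine (IsFrac.of_den_dvd (Finset.dvd_prod_of_mem (fun k => (I.u i k).den) (Finset.mem_univ _))).mono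
      (h2 ?_ ?_)
    · exact (natAbs_num_le _).trans (hpow (I.sz_util_le _ _ _))
    · exact (prod_den_le _ _).trans (hpow (I.sum_sz_util_le _ _))
  have hf : IsFrac (∏ e ∈ Finset.Ico 1 I.m, (I.f e).den) (2 ^ (2 * S)) (I.fac d) := by
    by_cases hd : 1 ≤ d ∧ d < I.m
    · have hmem := Finset.mem_Ico.2 hd
      rw [show I.fac d = I.f d by simp [fac, input, hd]]
      refine (IsFrac.of_den_dvd (Finset.dvd_prod_of_mem (fun e => (I.f e).den) hmem)).mono
        (h2 ?_ ?_)
      · exact (natAbs_num_le _).trans (hpow (I.sz_f_le _ hmem))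
      · exact (prod_den_le _ _).trans (hpow (I.sum_sz_f_le _))
    · rw [show I.fac d = 0 by simp [fac, input, hd]]
      exact .zero _ _
  refine (hu.mul hf).mono ?_
  rw [← pow_add, ← add_mul]

theorem sizeBound_bitSize (I : TDG ℚ) : I.SizeBound bitSize (7 * I.inputSize bitSize + 3) := by
  set S := I.inputSize bitSize with hS
  have hn : I.n + I.m ≤ S := by rw [hS]; unfold inputSize; omega
  have hzero : bitSize 0 = 2 := by decide
  have hQ : ∀ i : Fin I.n, 0 < (∏ k, (I.u i k).den) * ∏ e ∈ Finset.Ico 1 I.m, (I.f e).den :=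
    fun i => Nat.mul_pos (Finset.prod_pos fun _ _ => Rat.den_pos _)
      (Finset.prod_pos fun _ _ => Rat.den_pos _)
  have hQS : ∀ i : Fin I.n,
      (∏ k, (I.u i k).den) * ∏ e ∈ Finset.Ico 1 I.m, (I.f e).den ≤ 2 ^ (2 * S) := fun i => by
    rw [two_mul, pow_add]
    exact Nat.mul_le_mul
      ((prod_den_le _ _).trans (Nat.pow_le_pow_right two_pos (I.sum_sz_util_le _ _)))
      ((prod_den_le _ _).trans (Nat.pow_le_pow_right two_pos (I.sum_sz_f_le _)))
  refine ⟨by omega, by omega, fun a k => ?_, fun i hi j hj d => ?_, fun i hi k hk d => ?_⟩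
  · simp only [input]
    split_ifs with _ _ _ hk
    · exact (I.sz_util_le bitSize _ _).trans (by omega)
    · omega
    · exact (I.sz_f_le bitSize (Finset.mem_Ico.2 hk)).trans (by omega)
    · omega
    · omega
  · refine ((I.isFrac_util_mul_fac ⟨i, hi⟩ hj d).bitSize_le (hQ _) (hQS _) le_rfl).trans ?_
    omega
  -- There are at most `S ≤ 2 ^ S` summands, so the numerator is at most `2 ^ (5 * S)`. With the
  -- denominator at most `2 ^ (2 * S)` the bit length is at most `7 * S + 3`.
  · have := IsFrac.sum_range fun j (hj : j < k) =>
      I.isFrac_util_mul_fac ⟨i, hi⟩ (hj.trans_le hk) (d j)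
    refine (this.bitSize_le (b := 5 * S) (hQ _) (hQS _) ?_).trans (by omega)
    rw [show 5 * S = S + 4 * S by ring, pow_add]
    exact Nat.mul_le_mul_right _ (Nat.lt_two_pow_self.le.trans
      (Nat.pow_le_pow_right two_pos (by omega)))

end TDG

theorem IRProg.decidesIRInPolyTime_main {K : Type} [Field K] [LinearOrder K]
    [IsStrictOrderedRing K] {sz : K → ℕ}
    (h : ∀ I : TDG K, I.SizeBound sz (7 * I.inputSize sz + 3)) :
    IRProg.main.DecidesIRInPolyTime sz fun I => I.AtMostOneHasEnemies := by
  obtain ⟨q, hq⟩ := IRProg.main.polyBounded_costBound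
  refine ⟨q.comp (.C 7 * .X + .C 3), fun I hI => ?_⟩
  obtain ⟨t, s, he, ht, -, hs⟩ := runs_main (h I)
  refine ⟨t, s, he, (ht.trans (hq _)).trans (by simp [Polynomial.eval_comp]), ?_⟩
  rw [hs, I.hasIRAssignment_iff hI]

/-- One program solves the problem in polynomial time when at most one agent has enemies: for real
data on the real RAM (unit cost arithmetic), and for rational data in the bit model
(logarithmic cost). -/
theorem mainTheorem5 :
    ∃ p : Prog,
      p.DecidesIRInPolyTime unitSize (fun I : TDG ℝ => I.AtMostOneHasEnemies) ∧
      p.DecidesIRInPolyTime bitSize (fun I : TDG ℚ => I.AtMostOneHasEnemies) :=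
  ⟨IRProg.main, IRProg.decidesIRInPolyTime_main TDG.sizeBound_unitSize,
    IRProg.decidesIRInPolyTime_main TDG.sizeBound_bitSize⟩
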